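/- For an integer $m\ge 0$ let $\overline{\mathcal{EO}}(m)$ be the number of partitions of $m$ in which every even part is less than each odd part and only the largest even part appears an odd number of times; that is, the largest even part (if there are even parts) appears an odd number of times and every other part appears an even number of times. Put $\overline{\mathcal{EO}}(m)=0$ for integers $m<0$. Let $k, n$ be nonnegative integers and let $p_1,\dots,p_{k+1}$ be primes, not necessarily distinct, such that for each $i$ with $1\le i\le k+1$ we have $p_i\equiv 1 \pmod{24}$ and $\overline{\mathcal{EO}}\left(\frac{19p_i-1}{3}\right)\equiv 0 \pmod 8$. Then for every integer $j\not\equiv 0 \pmod{p_{k+1}}$ the number $\frac{p_1^2\cdots p_k^2\,p_{k+1}(24j+19p_{k+1})-1}{3}$ is an integer and $$\overline{\mathcal{EO}}\left(8p_1^2\cdots p_{k+1}^2\, n+\frac{p_1^2\cdots p_k^2\,p_{k+1}(24j+19p_{k+1})-1}{3}\right)\equiv 0 \pmod 8.$$ In particular, for all integers $n\ge 0$ and all integers $j$ with $1009\nmid j$, $$\overline{\mathcal{EO}}(8144648n+8072j+6447846)\equiv 0 \pmod 8.$$ -/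

import Mathlib

/-- Every even part of the partition is less than each odd part. -/
def EvenBelowOdd {n : ℕ} (P : n.Partition) : Prop :=
  ∀ a ∈ P.parts, ∀ b ∈ P.parts, Even a → Odd b → a < b

/-- `a` is the largest even part of the partition `P`. -/
def IsLargestEvenPart {n : ℕ} (P : n.Partition) (a : ℕ) : Prop :=
  a ∈ P.parts ∧ Even a ∧ ∀ b ∈ P.parts, Even b → b ≤ a

/-- Every even part is less than each odd part, and only the largest even part appears an odd
number of times: the parts of odd multiplicity are precisely the largest even part if there are
even parts, and there is no part of odd multiplicity if there are no even parts. -/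
def OnlyLargestEvenOdd {n : ℕ} (P : n.Partition) : Prop :=
  EvenBelowOdd P ∧ ∀ a ∈ P.parts, Odd (P.parts.count a) ↔ IsLargestEvenPart P a

/-- The number of partitions of the natural number `n` in which every even part is less than each
odd part and only the largest even part appears an odd number of times. -/
noncomputable def eoBarNat (n : ℕ) : ℕ :=
  Nat.card {P : n.Partition // OnlyLargestEvenOdd P}

/-- Andrews' partition function at an integer argument; a negative integer has no partitions. -/
noncomputable def EOBar (m : ℤ) : ℕ :=
  if 0 ≤ m then eoBarNat m.toNat else 0

/-!
Write `EObar` for Andrews' counting function and `f_k = ∏ (1 - q^(k i))`. Removing one copy of the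
largest even part and halving all multiplicities turns the partitions of `2 n` that `EObar` counts
into ordinary partitions of `n - s` whose even parts are at most `2 s` and whose odd parts exceed
`2 s`. Summing over `s` with the functional equation of the `q`-binomial theorem gives
`∑ EObar(2n) qⁿ = f₂³ / f₁²` (`eulerSeries_sq_mul_weightedSeries`).

By Gauss, `f₁² / f₂ = φ(-q) = 1 + 2 T`, so the generating function is `f₂² / (1 + 2 T)`. Modulo `8`
the factor `1 / (1 + 2 T)` is `(1 - 2 T) (1 + 4 T(q²))`, and the terms with exponent `4 n + 3` can
be read off: up to a multiple of `8` they add up to `4 q³ (f₁ ψ(q²) ψ(q⁴))(q⁴)`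
(`exists_weightedSeries_zero_eq`). Modulo `2` one has `ψ = f₁³`, again by Gauss, whence
`f₁ ψ(q²) ψ(q⁴) = f₁¹⁹ = ψ f₁₆`; triangular and pentagonal numbers turn its coefficients into
numbers of representations. The result is that `EObar(8n+6)` is congruent modulo `8` to the number
of integer solutions of `3x² + 16y² = 24 n + 19` with `y` odd (`eoBarNat_eight_mul_add_six`).

A prime `p ≡ 1 (mod 24)` has the form `u² + 48w²`, hence splits in `ℤ[√-3]` as the product of
`u ± 4w√-3`. Multiplying `4y + x√-3` by such a factor gives a Hecke relation between the numbers of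
representations of `p m`, of `m / p` and, with the parity of `y` shifted by `w`, of `m`
(`card_repsOfParity_prime_mul`). Up to signs the representations come in fours, so modulo `8` the
number of representations of `p m` is the negative of that of `m / p`, and it vanishes if `p ∤ m`.
An odd exponent of `p` in `24 n + 19` therefore forces `8 ∣ EObar(8n+6)`. The arguments in the theorem
are those `v` for which `3 v + 1 = (p₁ ⋯ p_k)² p_{k+1} M` with `p_{k+1} ∤ M`, so the exponent of
`p_{k+1}` is odd.

The two identities of Gauss are limits of finite identities of Shanks
(`prod_one_add_pow_mul_sum_sq`, `prod_one_sub_odd_pow_mul_sum_triangular`).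
-/

/-! ### Primes congruent to one modulo twenty-four -/

/-- Thue's lemma, for a square root of `-3` modulo a prime. -/
theorem exists_small_sq_add_three_mul_sq {p : ℕ} [Fact p.Prime] {a : ZMod p} (ha : a ^ 2 = -3) :
    ∃ x y : ℤ, (p : ℤ) ∣ x ^ 2 + 3 * y ^ 2 ∧ 0 < x ^ 2 + 3 * y ^ 2 ∧ x ^ 2 < p ∧ y ^ 2 < p := by
  have hp : p.Prime := Fact.out
  set r := Nat.sqrt p with hr
  have hlt : p < (r + 1) * (r + 1) := Nat.lt_succ_sqrt p
  have hrr : r * r < p := by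
    refine lt_of_le_of_ne (Nat.sqrt_le p) fun h => ?_
    exact hp.prime.irreducible.not_isSquare ⟨r, h.symm⟩
  have hcard : (Finset.univ : Finset (ZMod p)).card <
      (Finset.range (r + 1) ×ˢ Finset.range (r + 1)).card := by
    simpa [ZMod.card] using hlt
  obtain ⟨⟨i, j⟩, h1, ⟨i', j'⟩, h2, hne, heq⟩ :=
    Finset.exists_ne_map_eq_of_card_lt_of_maps_to hcard
      (f := fun z : ℕ × ℕ => (z.1 : ZMod p) - a * z.2)
      (fun _ _ => Finset.mem_coe.2 (Finset.mem_univ _))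
  simp only [Finset.mem_product, Finset.mem_range] at h1 h2
  have hbound : ∀ m n : ℕ, m < r + 1 → n < r + 1 → ((m : ℤ) - n) ^ 2 < p := by
    intro m n hm hn
    have : ((m : ℤ) - n) ^ 2 ≤ (r : ℤ) ^ 2 := sq_le_sq' (by lia) (by lia)
    have : (r : ℤ) * r < p := by exact_mod_cast hrr
    nlinarith
  refine ⟨(i : ℤ) - i', (j : ℤ) - j', ?_, ?_, hbound _ _ h1.1 h2.1, hbound _ _ h1.2 h2.2⟩
  · rw [← ZMod.intCast_zmod_eq_zero_iff_dvd]
    have h : (i : ZMod p) - i' = a * (j - j') := by linear_combination heq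
    push_cast
    rw [h]
    linear_combination ((j : ZMod p) - j') ^ 2 * ha
  · by_contra hcon
    have hi : ((i : ℤ) - i') = 0 := by
      nlinarith [sq_nonneg ((i : ℤ) - i'), sq_nonneg ((j : ℤ) - j')]
    have hj : ((j : ℤ) - j') = 0 := by
      nlinarith [sq_nonneg ((i : ℤ) - i'), sq_nonneg ((j : ℤ) - j')]
    exact hne (Prod.ext (by simp only; lia) (by simp only; lia))

theorem sq_emod_eight (x : ℤ) : x ^ 2 % 8 = 0 ∨ x ^ 2 % 8 = 1 ∨ x ^ 2 % 8 = 4 := by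
  rcases (by lia : x % 8 = 0 ∨ x % 8 = 1 ∨ x % 8 = 2 ∨ x % 8 = 3 ∨ x % 8 = 4 ∨ x % 8 = 5 ∨
    x % 8 = 6 ∨ x % 8 = 7) with h | h | h | h | h | h | h | h <;> simp [pow_two, Int.mul_emod, h]

theorem exists_eq_sq_add_fortyEight_mul_sq {p : ℕ} (hp : p.Prime) (h24 : p % 24 = 1) :
    ∃ u w : ℤ, (p : ℤ) = u ^ 2 + 48 * w ^ 2 := by
  have : Fact p.Prime := ⟨hp⟩
  have h3 : IsSquare (((3 : ℕ) : ZMod p)) := by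
    rw [ZMod.exists_sq_eq_prime_iff_of_mod_four_eq_one (by lia) (by norm_num)]
    have : ((p : ℕ) : ZMod 3) = 1 := by
      rw [← Nat.cast_one, ZMod.natCast_eq_natCast_iff]
      simp only [Nat.ModEq]; lia
    rw [this]; exact IsSquare.one
  have hm1 : IsSquare (-1 : ZMod p) := ZMod.exists_sq_eq_neg_one_iff.2 (by lia)
  obtain ⟨a, ha⟩ := hm1.mul h3
  have ha' : a ^ 2 = -3 := by rw [sq, ← ha]; push_cast; ring
  obtain ⟨x, y, ⟨k, hk⟩, hpos, hx, hy⟩ := exists_small_sq_add_three_mul_sq ha'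
  have hp0 : (0 : ℤ) < p := by exact_mod_cast hp.pos
  have hk0 : 0 < k := by by_contra h; nlinarith
  have hk4 : k < 4 := by by_contra h; nlinarith
  have key : ∃ u v : ℤ, (p : ℤ) = u ^ 2 + 3 * v ^ 2 := by
    have hx8 := sq_emod_eight x
    have hy8 := sq_emod_eight y
    obtain rfl | rfl | rfl : k = 1 ∨ k = 2 ∨ k = 3 := by lia
    · exact ⟨x, y, by linarith⟩
    · exfalso; lia
    · obtain ⟨z, rfl⟩ : (3 : ℤ) ∣ x := Int.prime_three.dvd_of_dvd_pow (n := 2) (by lia)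
      exact ⟨y, z, by linarith⟩
  obtain ⟨u, v, huv⟩ := key
  have hu8 := sq_emod_eight u
  have hv8 := sq_emod_eight v
  have hv : v ^ 2 % 8 = 0 := by lia
  obtain ⟨t, rfl⟩ : (2 : ℤ) ∣ v := Int.prime_two.dvd_of_dvd_pow (n := 2) (by lia)
  obtain ⟨w, rfl⟩ : (2 : ℤ) ∣ t := Int.prime_two.dvd_of_dvd_pow (n := 2) (by lia)
  exact ⟨u, w, by rw [huv]; ring⟩

/-! ### Representations by the form `3x² + 16y²` -/

/-- The representations `n = 3x² + 16y²` with `y` of the parity of `e`. The box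
`|x|, |y| ≤ n` serves only to make the set a `Finset`; it contains every representation. -/
noncomputable def repsOfParity (e n : ℤ) : Finset (ℤ × ℤ) :=
  (Finset.Icc (-n) n ×ˢ Finset.Icc (-n) n).filter
    fun z => 3 * z.1 ^ 2 + 16 * z.2 ^ 2 = n ∧ 2 ∣ z.2 - e

theorem mem_repsOfParity {e n : ℤ} {z : ℤ × ℤ} :
    z ∈ repsOfParity e n ↔ 3 * z.1 ^ 2 + 16 * z.2 ^ 2 = n ∧ 2 ∣ z.2 - e := by
  simp only [repsOfParity, Finset.mem_filter, Finset.mem_product, Finset.mem_Icc,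
    and_iff_right_iff_imp]
  rintro ⟨h, -⟩
  have h1 : ∀ x : ℤ, x ≤ x ^ 2 ∧ -x ≤ x ^ 2 := fun x =>
    ⟨Int.le_self_sq x, by simpa using Int.le_self_sq (-x)⟩
  have := h1 z.1
  have := h1 z.2
  lia

theorem Finset.card_eq_two_mul_card_filter_of_involutive {α : Type*} {s : Finset α} {f : α → α}
    (hf : Function.Involutive f) (hs : ∀ a ∈ s, f a ∈ s) (P : α → Prop) [DecidablePred P]
    (hP : ∀ a ∈ s, P (f a) ↔ ¬ P a) : s.card = 2 * (s.filter P).card := by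
  have h : (s.filter P).card = (s.filter fun a => ¬ P a).card := by
    refine Finset.card_bij (fun a _ => f a) ?_ (fun a _ b _ h => hf.injective h) ?_
    · intro a ha
      rw [Finset.mem_filter] at ha ⊢
      exact ⟨hs a ha.1, by rw [hP a ha.1]; exact not_not.2 ha.2⟩
    · intro b hb
      rw [Finset.mem_filter] at hb
      exact ⟨f b, Finset.mem_filter.2 ⟨hs b hb.1, (hP b hb.1).2 hb.2⟩, hf b⟩
  rw [← Finset.card_filter_add_card_filter_not (s := s) P, ← h, two_mul]

/-- The sign changes of the two coordinates act freely on the representations. -/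
theorem four_dvd_card_repsOfParity {n : ℤ} (hn : n % 24 = 19) (e : ℤ) :
    4 ∣ (repsOfParity e n).card := by
  have hx : ∀ z ∈ repsOfParity e n, z.1 ≠ 0 := by
    intro z hz h
    rw [mem_repsOfParity, h] at hz
    lia
  have hy : ∀ z ∈ repsOfParity e n, z.2 ≠ 0 := by
    intro z hz h
    rw [mem_repsOfParity, h] at hz
    lia
  rw [Finset.card_eq_two_mul_card_filter_of_involutive (f := fun z : ℤ × ℤ => (-z.1, z.2))
      (fun z => by simp) ?_ (fun z => 0 < z.1) ?_,
    Finset.card_eq_two_mul_card_filter_of_involutive (f := fun z : ℤ × ℤ => (z.1, -z.2))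
      (fun z => by simp) ?_ (fun z => 0 < z.2) ?_, ← mul_assoc]
  · exact dvd_mul_right _ _
  · intro z hz
    rw [Finset.mem_filter, mem_repsOfParity] at hz ⊢
    refine ⟨⟨?_, ?_⟩, hz.2⟩
    · simpa using hz.1.1
    · have := hz.1.2
      simp only; lia
  · intro z hz
    have := hy z (Finset.mem_filter.1 hz).1
    simp only; lia
  · intro z hz
    rw [mem_repsOfParity] at hz ⊢
    simpa using hz
  · intro z hz
    have := hx z hz
    simp only; lia

section Multiplication

variable {p : ℕ} {u w : ℤ}

theorem not_dvd_of_eq_sq_add (hp : p.Prime) (huw : (p : ℤ) = u ^ 2 + 48 * w ^ 2) :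
    ¬ (p : ℤ) ∣ u := by
  have hpZ : Prime (p : ℤ) := Nat.prime_iff_prime_int.1 hp
  rintro ⟨c, rfl⟩
  have hp1 : (1 : ℤ) < p := by exact_mod_cast hp.one_lt
  rcases eq_or_ne c 0 with rfl | hc
  · have h48 : (p : ℤ) = 48 * w ^ 2 := by rw [huw]; ring_nf
    have hp48 : p = 48 * w.natAbs ^ 2 := by
      zify
      rw [sq_abs]
      exact h48
    have h2 : 2 ∣ p := ⟨24 * w.natAbs ^ 2, by lia⟩
    have h3 : 3 ∣ p := ⟨16 * w.natAbs ^ 2, by lia⟩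
    rw [Nat.prime_dvd_prime_iff_eq Nat.prime_two hp] at h2
    rw [Nat.prime_dvd_prime_iff_eq Nat.prime_three hp] at h3
    lia
  · have hc1 : 0 < c ^ 2 := by positivity
    have hc2 : (p : ℤ) ^ 2 ≤ (p * c) ^ 2 := by
      rw [mul_pow]
      exact le_mul_of_one_le_right (sq_nonneg _) hc1
    nlinarith [sq_nonneg w]

/-- The representations of `p m` that are divisible, as elements `4y + x√-3` of `ℤ[√-3]`, by
`u + 4w√-3`: the quotients represent `m`, and the parity of `y` is shifted by `w`. -/
theorem card_filter_dvd_repsOfParity (hp : p.Prime) (hp24 : p % 24 = 1)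
    (huw : (p : ℤ) = u ^ 2 + 48 * w ^ 2) {m : ℤ} (hm : m % 2 = 1) (e : ℤ) :
    ((repsOfParity e (p * m)).filter fun z => (p : ℤ) ∣ u * z.2 + 3 * w * z.1).card =
      (repsOfParity (e + w) m).card := by
  have hpZ : Prime (p : ℤ) := Nat.prime_iff_prime_int.1 hp
  have hp0 : (p : ℤ) ≠ 0 := hpZ.ne_zero
  have hu : u % 2 = 1 := by
    by_contra h
    obtain ⟨c, rfl⟩ : (2 : ℤ) ∣ u := by lia
    have : (p : ℤ) = 2 * (2 * c ^ 2 + 24 * w ^ 2) := by rw [huw]; ring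
    lia
  -- `x` is odd, so multiplication changes the parity of `y` exactly by that of `w`
  have hodd : ∀ x y : ℤ, 3 * x ^ 2 + 16 * y ^ 2 = m → x % 2 = 1 := by
    intro x y h
    by_contra hx
    obtain ⟨c, rfl⟩ : (2 : ℤ) ∣ x := by lia
    have : m = 2 * (6 * c ^ 2 + 8 * y ^ 2) := by rw [← h]; ring
    lia
  have hpar : ∀ x y : ℤ, x % 2 = 1 → (2 : ℤ) ∣ (u * y - 3 * w * x) - (y + w) := by
    intro x y hx
    obtain ⟨a, rfl⟩ : ∃ a, x = 2 * a + 1 := ⟨x / 2, by lia⟩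
    obtain ⟨b, rfl⟩ : ∃ b, u = 2 * b + 1 := ⟨u / 2, by lia⟩
    exact ⟨b * y - 3 * w * a - 2 * w, by ring⟩
  symm
  refine Finset.card_bij (fun z _ => (u * z.1 + 16 * w * z.2, u * z.2 - 3 * w * z.1)) ?_ ?_ ?_
  · rintro ⟨x, y⟩ hz
    rw [mem_repsOfParity] at hz
    rw [Finset.mem_filter, mem_repsOfParity]
    simp only at hz ⊢
    refine ⟨⟨?_, ?_⟩, y, ?_⟩
    · rw [huw, ← hz.1]; ring
    · have := hpar x y (hodd x y hz.1)
      have := hz.2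
      lia
    · rw [huw]; ring
  · rintro ⟨x, y⟩ - ⟨x', y'⟩ - h
    simp only [Prod.mk.injEq] at h
    obtain ⟨h1, h2⟩ := h
    refine Prod.ext ?_ ?_
    · apply mul_left_cancel₀ hp0
      simp only [huw]
      linear_combination u * h1 - 16 * w * h2
    · apply mul_left_cancel₀ hp0
      simp only [huw]
      linear_combination 3 * w * h1 + u * h2
  · rintro ⟨x, y⟩ hz
    rw [Finset.mem_filter, mem_repsOfParity] at hz
    simp only at hz
    obtain ⟨⟨hz, hpe⟩, Y, hY⟩ := hz
    have hnorm : 16 * (u * y + 3 * w * x) ^ 2 + 3 * (u * x - 16 * w * y) ^ 2 =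
        (p : ℤ) * (p * m) := by
      rw [← hz, huw]; ring
    obtain ⟨X, hX⟩ : (p : ℤ) ∣ u * x - 16 * w * y := by
      have h3 : (p : ℤ) ∣ 3 * (u * x - 16 * w * y) ^ 2 :=
        ⟨p * m - 16 * p * Y ^ 2, by rw [hY] at hnorm; linear_combination hnorm⟩
      refine (hpZ.dvd_or_dvd h3).elim (fun h => ?_) hpZ.dvd_of_dvd_pow
      have : p ∣ 3 := by exact_mod_cast h
      rw [Nat.prime_dvd_prime_iff_eq hp Nat.prime_three] at this
      lia
    have hm' : 3 * X ^ 2 + 16 * Y ^ 2 = m := by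
      apply mul_left_cancel₀ hp0
      apply mul_left_cancel₀ hp0
      rw [← hnorm, hX, hY]; ring
    have hx : u * X + 16 * w * Y = x := by
      apply mul_left_cancel₀ hp0
      calc (p : ℤ) * (u * X + 16 * w * Y) = u * (p * X) + 16 * w * (p * Y) := by ring
        _ = p * x := by rw [← hX, ← hY, huw]; ring
    have hy : u * Y - 3 * w * X = y := by
      apply mul_left_cancel₀ hp0
      calc (p : ℤ) * (u * Y - 3 * w * X) = u * (p * Y) - 3 * w * (p * X) := by ring
        _ = p * y := by rw [← hX, ← hY, huw]; ring
    refine ⟨(X, Y), ?_, Prod.ext hx hy⟩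
    rw [mem_repsOfParity]
    refine ⟨hm', ?_⟩
    have := hpar X Y (hodd X Y hm')
    rw [hy] at this
    simp only
    lia

/-- The Hecke relation at a prime `p = u² + 48w²`: a representation of `p m` is divisible by
one of the two prime factors of `p` in `ℤ[√-3]`, and by both of them exactly when it is divisible
by `p`. -/
theorem card_repsOfParity_prime_mul (hp : p.Prime) (hp24 : p % 24 = 1)
    (huw : (p : ℤ) = u ^ 2 + 48 * w ^ 2) {m : ℤ} (hm : m % 2 = 1) (e : ℤ) :
    (repsOfParity e (p * m)).card +
      ((repsOfParity e (p * m)).filter fun z => (p : ℤ) ∣ z.1 ∧ (p : ℤ) ∣ z.2).card =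
      2 * (repsOfParity (e + w) m).card := by
  have hpZ : Prime (p : ℤ) := Nat.prime_iff_prime_int.1 hp
  have hpu := not_dvd_of_eq_sq_add hp huw
  have hpsmall : ∀ q : ℕ, q.Prime → q < 5 → ¬ (p : ℤ) ∣ q := by
    intro q hq hq5 h
    have h' : p ∣ q := by exact_mod_cast h
    rw [Nat.prime_dvd_prime_iff_eq hp hq] at h'
    subst h'
    have := hq.two_le
    lia
  have hp2 : ¬ (p : ℤ) ∣ 2 := hpsmall 2 Nat.prime_two (by norm_num)
  have hp3 : ¬ (p : ℤ) ∣ 3 := hpsmall 3 Nat.prime_three (by norm_num)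
  have hpw : ¬ (p : ℤ) ∣ w := by
    rintro ⟨c, rfl⟩
    apply hpu
    refine hpZ.dvd_of_dvd_pow (n := 2) ⟨1 - 48 * p * c ^ 2, ?_⟩
    linear_combination -huw
  have hplus := card_filter_dvd_repsOfParity hp hp24 huw hm e
  have hminus : ((repsOfParity e (p * m)).filter fun z => (p : ℤ) ∣ u * z.2 - 3 * w * z.1).card =
      (repsOfParity (e + w) m).card := by
    rw [← hplus]
    refine Finset.card_bij (fun z _ => (-z.1, z.2)) ?_ ?_ ?_
    · rintro ⟨x, y⟩ hz
      rw [Finset.mem_filter, mem_repsOfParity] at hz ⊢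
      simpa [sub_eq_add_neg] using hz
    · rintro ⟨x, y⟩ - ⟨x', y'⟩ - h
      simpa using h
    · rintro ⟨x, y⟩ hz
      refine ⟨(-x, y), ?_, by simp⟩
      rw [Finset.mem_filter, mem_repsOfParity] at hz ⊢
      simpa [sub_eq_add_neg] using hz
  have hunion : (repsOfParity e (p * m)).filter (fun z => (p : ℤ) ∣ u * z.2 + 3 * w * z.1) ∪
      (repsOfParity e (p * m)).filter (fun z => (p : ℤ) ∣ u * z.2 - 3 * w * z.1) =
      repsOfParity e (p * m) := by
    rw [← Finset.filter_or, Finset.filter_eq_self]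
    rintro ⟨x, y⟩ hz
    rw [mem_repsOfParity] at hz
    simp only at hz ⊢
    apply hpZ.dvd_or_dvd
    refine ⟨y ^ 2 - 3 * w ^ 2 * m, ?_⟩
    linear_combination (y ^ 2) * (-huw) - 3 * w ^ 2 * hz.1
  have hinter : (repsOfParity e (p * m)).filter (fun z => (p : ℤ) ∣ u * z.2 + 3 * w * z.1) ∩
      (repsOfParity e (p * m)).filter (fun z => (p : ℤ) ∣ u * z.2 - 3 * w * z.1) =
      (repsOfParity e (p * m)).filter fun z => (p : ℤ) ∣ z.1 ∧ (p : ℤ) ∣ z.2 := by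
    rw [← Finset.filter_and]
    refine Finset.filter_congr ?_
    rintro ⟨x, y⟩ -
    simp only
    constructor
    · rintro ⟨h1, h2⟩
      constructor
      · have h : (p : ℤ) ∣ 2 * (3 * (w * x)) := by
          have := dvd_sub h1 h2
          ring_nf at this ⊢
          exact this
        have h := (hpZ.dvd_or_dvd h).resolve_left hp2
        have h := (hpZ.dvd_or_dvd h).resolve_left hp3
        exact (hpZ.dvd_or_dvd h).resolve_left hpw
      · have h : (p : ℤ) ∣ 2 * (u * y) := by
          have := dvd_add h1 h2
          ring_nf at this ⊢
          exact this
        have h := (hpZ.dvd_or_dvd h).resolve_left hp2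
        exact (hpZ.dvd_or_dvd h).resolve_left hpu
    · rintro ⟨⟨a, rfl⟩, ⟨b, rfl⟩⟩
      exact ⟨⟨u * b + 3 * w * a, by ring⟩, ⟨u * b - 3 * w * a, by ring⟩⟩
  rw [← hinter]
  nth_rewrite 1 [← hunion]
  rw [Finset.card_union_add_card_inter, hplus, hminus, two_mul]

theorem card_filter_dvd_repsOfParity_sq_mul (hp : p.Prime) (hp24 : p % 24 = 1) (e m : ℤ) :
    ((repsOfParity e (p * (p * m))).filter fun z => (p : ℤ) ∣ z.1 ∧ (p : ℤ) ∣ z.2).card =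
      (repsOfParity e m).card := by
  have hp0 : (p : ℤ) ≠ 0 := by exact_mod_cast hp.ne_zero
  have hpar : ∀ y : ℤ, (2 : ℤ) ∣ p * y - e ↔ (2 : ℤ) ∣ y - e := by
    intro y
    obtain ⟨c, hc⟩ : ∃ c : ℤ, (p : ℤ) = 2 * c + 1 := ⟨p / 2, by lia⟩
    have : (p : ℤ) * y = 2 * (c * y) + y := by rw [hc]; ring
    lia
  symm
  refine Finset.card_bij (fun z _ => (p * z.1, p * z.2)) ?_ ?_ ?_
  · rintro ⟨x, y⟩ hz
    rw [mem_repsOfParity] at hz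
    rw [Finset.mem_filter, mem_repsOfParity]
    simp only at hz ⊢
    exact ⟨⟨by rw [← hz.1]; ring, (hpar y).2 hz.2⟩, dvd_mul_right _ _, dvd_mul_right _ _⟩
  · rintro ⟨x, y⟩ - ⟨x', y'⟩ - h
    simpa [hp.ne_zero] using h
  · rintro ⟨x, y⟩ hz
    rw [Finset.mem_filter, mem_repsOfParity] at hz
    simp only at hz
    obtain ⟨⟨hz, hpe⟩, ⟨a, rfl⟩, ⟨b, rfl⟩⟩ := hz
    refine ⟨(a, b), ?_, rfl⟩
    rw [mem_repsOfParity]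
    refine ⟨?_, (hpar b).1 hpe⟩
    apply mul_left_cancel₀ hp0
    apply mul_left_cancel₀ hp0
    rw [← hz]; ring

end Multiplication

/-- A prime `p ≡ 1 (mod 24)` of odd exponent in `n` forces the number of representations of `n`,
up to signs, to be even. -/
theorem eight_dvd_card_repsOfParity {p : ℕ} (hp : p.Prime) (hp24 : p % 24 = 1) {m : ℤ}
    (hpm : ¬ (p : ℤ) ∣ m) (hm : m % 24 = 19) (e : ℤ) (a : ℕ) :
    8 ∣ (repsOfParity e (p ^ (2 * a + 1) * m)).card := by
  obtain ⟨u, w, huw⟩ := exists_eq_sq_add_fortyEight_mul_sq hp hp24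
  have hpow : ∀ k : ℕ, ((p : ℤ) ^ k * m) % 24 = 19 := by
    intro k
    rw [Int.mul_emod, hm]
    have : ((p : ℤ) ^ k) % 24 = 1 := by
      have h1 : (p : ℤ) ≡ 1 [ZMOD 24] := by simp only [Int.ModEq]; lia
      simpa [Int.ModEq] using h1.pow k
    rw [this]; norm_num
  induction a with
  | zero =>
    have h := card_repsOfParity_prime_mul hp hp24 huw (m := m) (by lia) e
    have hempty : ((repsOfParity e (p * m)).filter
        fun z => (p : ℤ) ∣ z.1 ∧ (p : ℤ) ∣ z.2) = ∅ := by
      rw [Finset.filter_eq_empty_iff]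
      rintro ⟨x, y⟩ hz ⟨⟨a, ha⟩, ⟨b, hb⟩⟩
      rw [mem_repsOfParity] at hz
      simp only at hz ha hb
      apply hpm
      refine ⟨3 * a ^ 2 + 16 * b ^ 2, ?_⟩
      apply mul_left_cancel₀ (show (p : ℤ) ≠ 0 by exact_mod_cast hp.ne_zero)
      rw [← hz.1, ha, hb]; ring
    rw [hempty, Finset.card_empty] at h
    have := four_dvd_card_repsOfParity hm (e + w)
    simp only [mul_zero, zero_add, pow_one]
    lia
  | succ a ih =>
    have h := card_repsOfParity_prime_mul hp hp24 huw (m := p * (p ^ (2 * a + 1) * m))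
      (by have := hpow (2 * a + 2); rw [pow_succ', mul_assoc] at this; lia) e
    rw [card_filter_dvd_repsOfParity_sq_mul hp hp24] at h
    have h4 := four_dvd_card_repsOfParity (hpow (2 * a + 2)) (e + w)
    rw [show (p : ℤ) ^ (2 * (a + 1) + 1) * m = p * (p * (p ^ (2 * a + 1) * m)) by ring]
    rw [show (p : ℤ) ^ (2 * a + 2) * m = p * (p ^ (2 * a + 1) * m) by ring] at h4
    lia

section Series

open Filter Topology PowerSeries PowerSeries.WithPiTopology

/-! ### Finite forms of Gauss's identities -/

section Finite

variable {R : Type*} [CommRing R]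

/-- Shanks's finite form of Gauss's identity
`∏ (1 - qⁱ) / (1 + qⁱ) = ∑ (-1)ˢ q^(s²)`, with denominators cleared. -/
theorem prod_one_add_pow_mul_sum_sq (q : R) (n : ℕ) :
    (∏ i ∈ Finset.range n, (1 + q ^ (i + 1))) *
        (1 + 2 * ∑ s ∈ Finset.range n, (-1) ^ (s + 1) * q ^ (s + 1) ^ 2) =
      ∏ i ∈ Finset.range n, (1 - q ^ (i + 1)) +
        2 * ∑ s ∈ Finset.range n, (-1) ^ (s + 1) * q ^ ((s + 1) * (n + 1)) *
          ((∏ i ∈ Finset.Ico (s + 1) n, (1 - q ^ (i + 1))) *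
            ∏ i ∈ Finset.range s, (1 + q ^ (i + 1))) := by
  induction n with
  | zero => simp
  | succ n ih =>
    -- the difference of the summands for `n + 1` and `n` telescopes, through `g`
    set g : ℕ → R := fun s => (∏ i ∈ Finset.Ico s n, (1 - q ^ (i + 1))) *
      (∏ i ∈ Finset.range s, (1 + q ^ (i + 1))) * q ^ ((s + 1) * (n + 1)) with hg
    have hstep : ∀ s ∈ Finset.range n,
        (-1) ^ (s + 1) * q ^ ((s + 1) * (n + 1 + 1)) *
          ((∏ i ∈ Finset.Ico (s + 1) (n + 1), (1 - q ^ (i + 1))) *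
            ∏ i ∈ Finset.range s, (1 + q ^ (i + 1))) =
        (1 + q ^ (n + 1)) * ((-1) ^ (s + 1) * q ^ ((s + 1) * (n + 1)) *
          ((∏ i ∈ Finset.Ico (s + 1) n, (1 - q ^ (i + 1))) *
            ∏ i ∈ Finset.range s, (1 + q ^ (i + 1)))) +
        ((-1) ^ s * g s - (-1) ^ (s + 1) * g (s + 1)) := by
      intro s hs
      rw [Finset.mem_range] at hs
      simp only [hg]
      rw [Finset.prod_Ico_succ_top (by lia), Finset.prod_eq_prod_Ico_succ_bot hs,
        Finset.prod_range_succ]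
      ring
    rw [Finset.prod_range_succ, Finset.prod_range_succ _ n, Finset.sum_range_succ,
      Finset.sum_range_succ _ n, Finset.sum_congr rfl hstep, Finset.sum_add_distrib,
      ← Finset.mul_sum, Finset.sum_range_sub', Finset.Ico_self]
    have hg0 : g 0 = (∏ i ∈ Finset.range n, (1 - q ^ (i + 1))) * q ^ (n + 1) := by
      simp only [hg, Finset.range_zero, Finset.prod_empty, mul_one, ← Finset.range_eq_Ico,
        zero_add, one_mul]
    have hgn : g n = (∏ i ∈ Finset.range n, (1 + q ^ (i + 1))) * q ^ ((n + 1) * (n + 1)) := by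
      simp [hg]
    rw [hg0, hgn, Finset.prod_empty]
    linear_combination (1 + q ^ (n + 1)) * ih

/-- Shanks's finite form of Gauss's identity
`∏ (1 - q²ⁱ) / (1 - q²ⁱ⁻¹) = ∑ q^(s(s+1)/2)`, with denominators cleared. -/
theorem prod_one_sub_odd_pow_mul_sum_triangular (q : R) (n : ℕ) :
    (∏ i ∈ Finset.range n, (1 - q ^ (2 * i + 1))) *
        ∑ s ∈ Finset.range (2 * n), q ^ (s * (s + 1) / 2) =
      ∑ s ∈ Finset.range n, q ^ (s * (2 * n + 1)) *
        ((∏ i ∈ Finset.Ico s n, (1 - q ^ (2 * i + 2))) *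
          ∏ i ∈ Finset.range s, (1 - q ^ (2 * i + 1))) := by
  induction n with
  | zero => simp
  | succ n ih =>
    set h : ℕ → R := fun s => q ^ (s * (2 * n + 1)) * (1 - q ^ (2 * s)) *
      ((∏ i ∈ Finset.Ico s n, (1 - q ^ (2 * i + 2))) *
          ∏ i ∈ Finset.range s, (1 - q ^ (2 * i + 1))) with hh
    have hstep : ∀ s ∈ Finset.range n,
        q ^ (s * (2 * (n + 1) + 1)) * ((∏ i ∈ Finset.Ico s (n + 1), (1 - q ^ (2 * i + 2))) *
          ∏ i ∈ Finset.range s, (1 - q ^ (2 * i + 1))) =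
        (1 - q ^ (2 * n + 1)) * (q ^ (s * (2 * n + 1)) *
          ((∏ i ∈ Finset.Ico s n, (1 - q ^ (2 * i + 2))) *
            ∏ i ∈ Finset.range s, (1 - q ^ (2 * i + 1)))) + (h (s + 1) - h s) := by
      intro s hs
      rw [Finset.mem_range] at hs
      simp only [hh]
      rw [Finset.prod_Ico_succ_top hs.le, Finset.prod_eq_prod_Ico_succ_bot hs,
        Finset.prod_range_succ]
      ring
    have ht1 : (2 * n) * (2 * n + 1) / 2 = n * (2 * n + 1) := by
      rw [mul_assoc, Nat.mul_div_cancel_left _ (by norm_num)]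
    have ht2 : (2 * n + 1) * (2 * n + 1 + 1) / 2 = n * (2 * n + 1) + (2 * n + 1) := by
      rw [show (2 * n + 1) * (2 * n + 1 + 1) = 2 * (n * (2 * n + 1) + (2 * n + 1)) by ring,
        Nat.mul_div_cancel_left _ (by norm_num)]
    rw [show 2 * (n + 1) = 2 * n + 1 + 1 by ring, Finset.sum_range_succ _ (2 * n + 1),
      Finset.sum_range_succ _ (2 * n), ht1, ht2, Finset.sum_range_succ _ n,
      show 2 * n + 1 + 1 = 2 * (n + 1) by ring,
      Finset.sum_congr rfl hstep, Finset.sum_add_distrib, ← Finset.mul_sum, Finset.sum_range_sub,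
      Finset.prod_range_succ]
    have h0 : h 0 = 0 := by simp [hh]
    have hn : h n = q ^ (n * (2 * n + 1)) * (1 - q ^ (2 * n)) *
        ∏ i ∈ Finset.range n, (1 - q ^ (2 * i + 1)) := by simp [hh]
    rw [h0, hn, Nat.Ico_succ_singleton, Finset.prod_singleton]
    linear_combination (1 - q ^ (2 * n + 1)) * ih

end Finite

/-! ### Limits of power series -/

section Limits

theorem PowerSeries.tendsto_of_X_pow_dvd_sub {a : ℕ → ℤ⟦X⟧} {L : ℤ⟦X⟧}
    (h : ∀ n, (X : ℤ⟦X⟧) ^ n ∣ a n - L) : Tendsto a atTop (𝓝 L) := by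
  rw [tendsto_iff_coeff_tendsto]
  refine fun d => tendsto_atTop_of_eventually_const (i₀ := d + 1) fun n hn => ?_
  have := X_pow_dvd_iff.1 (h n) d (by lia)
  rwa [map_sub, sub_eq_zero] at this

theorem PowerSeries.tendsto_zero_of_X_pow_dvd {a : ℕ → ℤ⟦X⟧}
    (h : ∀ n, (X : ℤ⟦X⟧) ^ n ∣ a n) : Tendsto a atTop (𝓝 0) :=
  tendsto_of_X_pow_dvd_sub fun n => by simpa using h n

theorem PowerSeries.tendsto_expand {a : ℕ → ℤ⟦X⟧} {L : ℤ⟦X⟧} (h : Tendsto a atTop (𝓝 L))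
    (k : ℕ) (hk : k ≠ 0) : Tendsto (fun n => expand k hk (a n)) atTop (𝓝 (expand k hk L)) := by
  rw [tendsto_iff_coeff_tendsto] at h ⊢
  intro d
  simp only [coeff_expand]
  split_ifs
  · exact h _
  · exact tendsto_const_nhds

end Limits

/-! ### Theta series as products -/

/-- Euler's function `f₁ = ∏ (1 - Xⁱ)`, as a series over the integers; `f_k` is its expansion. -/
noncomputable def eulerSeries : ℤ⟦X⟧ := pentagonalSeries ℤ

/-- The series `T = ∑_{k ≥ 1} (-1)^k X^(k²)`, so that `1 + 2 T = φ(-q)` in Ramanujan's notation;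
the sign is written as `(-1)^(k²)`. -/
noncomputable def altSquareSeries : ℤ⟦X⟧ :=
  .mk fun n => if IsSquare n ∧ n ≠ 0 then (-1) ^ n else 0

/-- Ramanujan's `ψ = ∑_{k ≥ 0} X^(k(k+1)/2)`; the triangular numbers are those `n` for which
`8 n + 1` is a square. -/
noncomputable def triangularSeries : ℤ⟦X⟧ :=
  .mk fun n => if IsSquare (8 * n + 1) then 1 else 0

theorem tendsto_prod_one_sub_X_pow :
    Tendsto (fun n => ∏ i ∈ Finset.range n, (1 - (X : ℤ⟦X⟧) ^ (i + 1))) atTop (𝓝 eulerSeries) :=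
  (hasProd_one_sub_X_pow ℤ).tendsto_prod_nat

theorem tendsto_prod_one_sub_X_pow_even :
    Tendsto (fun n => ∏ i ∈ Finset.range n, (1 - (X : ℤ⟦X⟧) ^ (2 * i + 2))) atTop
      (𝓝 (expand 2 two_ne_zero eulerSeries)) := by
  refine (tendsto_expand tendsto_prod_one_sub_X_pow 2 two_ne_zero).congr fun n => ?_
  simp [map_prod, ← pow_mul, mul_add]

theorem eulerSeries_ne_zero : eulerSeries ≠ 0 := by
  intro h
  have := coeff_pentagonalSeries_pentagonal ℤ 0
  rw [show pentagonalSeries ℤ = 0 from h] at this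
  simp at this

theorem expand_eulerSeries_ne_zero {k : ℕ} (hk : k ≠ 0) : expand k hk eulerSeries ≠ 0 := by
  intro h
  apply eulerSeries_ne_zero
  ext n
  rw [← coeff_expand_mul k hk, h, map_zero, map_zero]

theorem tendsto_sum_alternating_X_pow_sq :
    Tendsto (fun n => ∑ s ∈ Finset.range n, (-1) ^ (s + 1) * (X : ℤ⟦X⟧) ^ (s + 1) ^ 2) atTop
      (𝓝 altSquareSeries) := by
  rw [tendsto_iff_coeff_tendsto]
  refine fun d => tendsto_atTop_of_eventually_const (i₀ := d) fun n hn => ?_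
  have hc : ∀ s, coeff d ((-1) ^ (s + 1) * (X : ℤ⟦X⟧) ^ (s + 1) ^ 2) =
      if d = (s + 1) ^ 2 then (-1) ^ (s + 1) else 0 := by
    intro s
    rw [show ((-1) ^ (s + 1) : ℤ⟦X⟧) = C ((-1) ^ (s + 1)) by simp, coeff_C_mul, coeff_X_pow]
    simp
  rw [map_sum, Finset.sum_congr rfl fun s _ => hc s, altSquareSeries, coeff_mk]
  split_ifs with h
  · obtain ⟨⟨r, hr⟩, h0⟩ := h
    obtain ⟨s, rfl⟩ : ∃ s, r = s + 1 := Nat.exists_eq_succ_of_ne_zero (by rintro rfl; simp_all)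
    have hs : s ∈ Finset.range n := by rw [Finset.mem_range]; nlinarith
    rw [Finset.sum_eq_single_of_mem s hs, if_pos (by rw [hr, sq])]
    · rw [hr, pow_mul]
      rcases Nat.even_or_odd (s + 1) with he | ho
      · simp [he.neg_one_pow]
      · simp [ho.neg_one_pow]
    · intro t _ ht
      rw [if_neg]
      rintro h
      apply ht
      have : (s + 1) ^ 2 = (t + 1) ^ 2 := by rw [← h, hr, sq]
      have := Nat.pow_left_injective (n := 2) (by norm_num) this
      lia
  · refine Finset.sum_eq_zero fun s _ => if_neg ?_
    rintro rfl
    exact h ⟨⟨s + 1, sq _⟩, by positivity⟩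

theorem isSquare_eight_mul_add_one_iff {d : ℕ} :
    IsSquare (8 * d + 1) ↔ ∃ s, d = s * (s + 1) / 2 := by
  have htri : ∀ s, 2 * (s * (s + 1) / 2) = s * (s + 1) := fun s =>
    Nat.mul_div_cancel' (Nat.even_mul_succ_self s).two_dvd
  constructor
  · rintro ⟨r, hr⟩
    obtain ⟨s, rfl⟩ : ∃ s, r = 2 * s + 1 := by
      refine ⟨r / 2, ?_⟩
      by_contra h
      obtain ⟨c, rfl⟩ : 2 ∣ r := by lia
      have : 2 * c * (2 * c) = 2 * (c * (2 * c)) := by ring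
      lia
    refine ⟨s, ?_⟩
    have := htri s
    nlinarith
  · rintro ⟨s, rfl⟩
    refine ⟨2 * s + 1, ?_⟩
    have := htri s
    nlinarith

theorem tendsto_sum_X_pow_triangular :
    Tendsto (fun n => ∑ s ∈ Finset.range n, (X : ℤ⟦X⟧) ^ (s * (s + 1) / 2)) atTop
      (𝓝 triangularSeries) := by
  have htri : ∀ s, 2 * (s * (s + 1) / 2) = s * (s + 1) := fun s =>
    Nat.mul_div_cancel' (Nat.even_mul_succ_self s).two_dvd
  rw [tendsto_iff_coeff_tendsto]
  refine fun d => tendsto_atTop_of_eventually_const (i₀ := d + 1) fun n hn => ?_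
  simp only [map_sum, coeff_X_pow, triangularSeries, coeff_mk]
  split_ifs with h
  · obtain ⟨s, hs⟩ := isSquare_eight_mul_add_one_iff.1 h
    have := htri s
    have hsn : s ∈ Finset.range n := by rw [Finset.mem_range]; nlinarith
    rw [Finset.sum_eq_single_of_mem s hsn, if_pos hs]
    intro t _ ht
    rw [if_neg]
    intro h'
    have := htri t
    rcases lt_or_gt_of_ne ht with h1 | h1 <;> nlinarith
  · exact Finset.sum_eq_zero fun s _ => if_neg fun hs =>
      h (isSquare_eight_mul_add_one_iff.2 ⟨s, hs⟩)

/-- Gauss: `f₂ φ(-q) = f₁²`. -/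
theorem expand_two_eulerSeries_mul_one_add :
    expand 2 two_ne_zero eulerSeries * (1 + 2 * altSquareSeries) = eulerSeries ^ 2 := by
  set M : ℕ → ℤ⟦X⟧ := fun n => ∏ i ∈ Finset.range n, (1 - (X : ℤ⟦X⟧) ^ (i + 1)) with hM
  have hM1 : Tendsto M atTop (𝓝 eulerSeries) := tendsto_prod_one_sub_X_pow
  set E : ℕ → ℤ⟦X⟧ := fun n => ∑ s ∈ Finset.range n, (-1) ^ (s + 1) * X ^ ((s + 1) * (n + 1)) *
    ((∏ i ∈ Finset.Ico (s + 1) n, (1 - X ^ (i + 1))) * ∏ i ∈ Finset.range s, (1 + X ^ (i + 1)))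
    with hE
  have hE0 : Tendsto E atTop (𝓝 0) := by
    refine tendsto_zero_of_X_pow_dvd fun n => Finset.dvd_sum fun s _ => ?_
    exact ((pow_dvd_pow X (by nlinarith)).mul_left _).mul_right _
  refine tendsto_nhds_unique (f := fun n => M n * M n + 2 * (M n * E n)) (l := atTop) ?_ ?_
  · refine (tendsto_prod_one_sub_X_pow_even.mul
      ((tendsto_sum_alternating_X_pow_sq.const_mul 2).const_add 1)).congr fun n => ?_
    have h := prod_one_add_pow_mul_sum_sq (X : ℤ⟦X⟧) n
    have hprod : ∏ i ∈ Finset.range n, (1 - (X : ℤ⟦X⟧) ^ (2 * i + 2)) =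
        M n * ∏ i ∈ Finset.range n, (1 + X ^ (i + 1)) := by
      rw [hM, ← Finset.prod_mul_distrib]
      exact Finset.prod_congr rfl fun i _ => by ring
    rw [hprod, mul_assoc, h, mul_add, hE]
    ring
  · simpa [sq] using (hM1.mul hM1).add ((hM1.mul hE0).const_mul 2)

theorem prod_one_sub_X_pow_two_mul (n : ℕ) :
    ∏ i ∈ Finset.range (2 * n), (1 - (X : ℤ⟦X⟧) ^ (i + 1)) =
      (∏ i ∈ Finset.range n, (1 - X ^ (2 * i + 1))) *
        ∏ i ∈ Finset.range n, (1 - X ^ (2 * i + 2)) := by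
  induction n with
  | zero => simp
  | succ n ih =>
    rw [show 2 * (n + 1) = 2 * n + 1 + 1 by ring, Finset.prod_range_succ, Finset.prod_range_succ,
      Finset.prod_range_succ, Finset.prod_range_succ, ih]
    ring

theorem tendsto_two_mul_atTop : Tendsto (fun n : ℕ => 2 * n) atTop atTop :=
  tendsto_id.const_mul_atTop' two_pos

/-- Gauss: `f₁ ψ = f₂²`. -/
theorem eulerSeries_mul_triangularSeries :
    eulerSeries * triangularSeries = expand 2 two_ne_zero eulerSeries ^ 2 := by
  set D : ℕ → ℤ⟦X⟧ := fun n => ∏ i ∈ Finset.range n, (1 - (X : ℤ⟦X⟧) ^ (2 * i + 2)) with hD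
  have hD1 : Tendsto D atTop (𝓝 (expand 2 two_ne_zero eulerSeries)) :=
    tendsto_prod_one_sub_X_pow_even
  set E : ℕ → ℤ⟦X⟧ := fun n => ∑ s ∈ Finset.range n, X ^ (s * (2 * n + 1)) *
    ((∏ i ∈ Finset.Ico s n, (1 - X ^ (2 * i + 2))) *
      ∏ i ∈ Finset.range s, (1 - X ^ (2 * i + 1))) with hE
  have hE1 : Tendsto E atTop (𝓝 (expand 2 two_ne_zero eulerSeries)) := by
    have hdiff : Tendsto (fun n => E n - D n) atTop (𝓝 0) := by
      refine tendsto_zero_of_X_pow_dvd fun n => ?_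
      cases n with
      | zero => simp
      | succ n =>
        simp only [hE, hD]
        rw [Finset.sum_range_succ']
        simp only [zero_mul, pow_zero, one_mul, Finset.range_zero, Finset.prod_empty, mul_one,
          ← Finset.range_eq_Ico, add_sub_cancel_right]
        exact Finset.dvd_sum fun s _ => (pow_dvd_pow X (by nlinarith)).mul_right _
    simpa using hdiff.add hD1
  refine tendsto_nhds_unique (f := fun n => D n * E n) (l := atTop) ?_ ?_
  · refine ((tendsto_prod_one_sub_X_pow.comp tendsto_two_mul_atTop).mul
      (tendsto_sum_X_pow_triangular.comp tendsto_two_mul_atTop)).congr fun n => ?_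
    simp only [Function.comp_apply, hE]
    rw [← prod_one_sub_odd_pow_mul_sum_triangular, prod_one_sub_X_pow_two_mul]
    ring
  · simpa [sq] using hD1.mul hE1

/-! ### Partitions with small even parts and large odd parts -/

/-- The parts allowed once the largest even part is `2 s`: the even ones up to `2 s` and the odd
ones above it. The value `s = 0` stands for the absence of even parts. -/
def SmallEvenOrLargeOdd (s i : ℕ) : Prop := (Even i ∧ i ≤ 2 * s) ∨ (Odd i ∧ 2 * s < i)

instance (s : ℕ) : DecidablePred (SmallEvenOrLargeOdd s) :=
  fun i => inferInstanceAs (Decidable ((Even i ∧ i ≤ 2 * s) ∨ (Odd i ∧ 2 * s < i)))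

/-- The generating function of the partitions into even parts up to `2 s` and odd parts above
`2 s`. -/
noncomputable def smallEvenLargeOddSeries (s : ℕ) : ℤ⟦X⟧ :=
  .mk fun n => ((Nat.Partition.restricted n (SmallEvenOrLargeOdd s)).card : ℤ)

theorem tendsto_smallEvenLargeOddSeries (s : ℕ) :
    Tendsto (fun n => ∏ i ∈ Finset.range n,
      if SmallEvenOrLargeOdd s (i + 1) then ∑' j : ℕ, (X : ℤ⟦X⟧) ^ ((i + 1) * j) else 1) atTop
      (𝓝 (smallEvenLargeOddSeries s)) :=
  (Nat.Partition.hasProd_powerSeriesMk_card_restricted ℤ (SmallEvenOrLargeOdd s)).tendsto_prod_nat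

theorem prod_smallEvenLargeOdd_mul_prod (s n : ℕ) :
    (∏ i ∈ Finset.range n,
      if SmallEvenOrLargeOdd s (i + 1) then (1 - (X : ℤ⟦X⟧) ^ (i + 1)) else 1) *
    (∏ i ∈ Finset.range n,
      if SmallEvenOrLargeOdd s (i + 1) then ∑' j : ℕ, (X : ℤ⟦X⟧) ^ ((i + 1) * j) else 1) = 1 := by
  rw [← Finset.prod_mul_distrib]
  refine Finset.prod_eq_one fun i _ => ?_
  split_ifs
  · simp_rw [pow_mul]
    exact one_sub_mul_tsum_pow_of_constantCoeff_eq_zero (by simp)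
  · simp

theorem prod_smallEvenLargeOdd_succ (s n : ℕ) :
    (1 - (X : ℤ⟦X⟧) ^ (2 * s + 2)) * (∏ i ∈ Finset.range (2 * s + 2 + n),
      if SmallEvenOrLargeOdd s (i + 1) then (1 - (X : ℤ⟦X⟧) ^ (i + 1)) else 1) =
    (1 - (X : ℤ⟦X⟧) ^ (2 * s + 1)) * (∏ i ∈ Finset.range (2 * s + 2 + n),
      if SmallEvenOrLargeOdd (s + 1) (i + 1) then (1 - (X : ℤ⟦X⟧) ^ (i + 1)) else 1) := by
  induction n with
  | zero =>
    have h1 : SmallEvenOrLargeOdd s (2 * s + 1) := by unfold SmallEvenOrLargeOdd; grind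
    have h2 : ¬ SmallEvenOrLargeOdd (s + 1) (2 * s + 1) := by unfold SmallEvenOrLargeOdd; grind
    have h3 : ¬ SmallEvenOrLargeOdd s (2 * s + 1 + 1) := by unfold SmallEvenOrLargeOdd; grind
    have h4 : SmallEvenOrLargeOdd (s + 1) (2 * s + 1 + 1) := by unfold SmallEvenOrLargeOdd; grind
    have h5 : ∀ i ∈ Finset.range (2 * s),
        (if SmallEvenOrLargeOdd s (i + 1) then (1 - (X : ℤ⟦X⟧) ^ (i + 1)) else 1) =
        if SmallEvenOrLargeOdd (s + 1) (i + 1) then (1 - (X : ℤ⟦X⟧) ^ (i + 1)) else 1 := by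
      intro i hi
      rw [Finset.mem_range] at hi
      have : SmallEvenOrLargeOdd s (i + 1) ↔ SmallEvenOrLargeOdd (s + 1) (i + 1) := by
        unfold SmallEvenOrLargeOdd; grind
      simp only [this]
    rw [add_zero, Finset.prod_range_succ, Finset.prod_range_succ, Finset.prod_range_succ,
      Finset.prod_range_succ, if_pos h1, if_neg h2, if_neg h3, if_pos h4,
      Finset.prod_congr rfl h5]
    ring
  | succ n ih =>
    have : SmallEvenOrLargeOdd s (2 * s + 2 + n + 1) ↔
        SmallEvenOrLargeOdd (s + 1) (2 * s + 2 + n + 1) := by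
      unfold SmallEvenOrLargeOdd; grind
    rw [← add_assoc, Finset.prod_range_succ, ← mul_assoc, ih, Finset.prod_range_succ, mul_assoc]
    simp only [this]

/-- Passing from `s` to `s + 1` allows the part `2 s + 2` and forbids the part `2 s + 1`. -/
theorem smallEvenLargeOddSeries_succ (s : ℕ) :
    (1 - X ^ (2 * s + 2)) * smallEvenLargeOddSeries (s + 1) =
      (1 - X ^ (2 * s + 1)) * smallEvenLargeOddSeries s := by
  have hshift : Tendsto (fun n => 2 * s + 2 + n) atTop atTop := by
    simpa only [add_comm] using tendsto_add_atTop_nat (2 * s + 2)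
  refine tendsto_nhds_unique
    (((tendsto_smallEvenLargeOddSeries (s + 1)).comp hshift).const_mul _)
    ((((tendsto_smallEvenLargeOddSeries s).comp hshift).const_mul _).congr fun n => ?_)
  simp only [Function.comp_apply]
  have h := prod_smallEvenLargeOdd_succ s n
  have h1 := prod_smallEvenLargeOdd_mul_prod s (2 * s + 2 + n)
  have h2 := prod_smallEvenLargeOdd_mul_prod (s + 1) (2 * s + 2 + n)
  set Z := ∏ i ∈ Finset.range (2 * s + 2 + n),
      if SmallEvenOrLargeOdd s (i + 1) then (1 - (X : ℤ⟦X⟧) ^ (i + 1)) else 1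
  set Z' := ∏ i ∈ Finset.range (2 * s + 2 + n),
      if SmallEvenOrLargeOdd (s + 1) (i + 1) then (1 - (X : ℤ⟦X⟧) ^ (i + 1)) else 1
  set V := ∏ i ∈ Finset.range (2 * s + 2 + n),
      if SmallEvenOrLargeOdd s (i + 1) then ∑' j : ℕ, (X : ℤ⟦X⟧) ^ ((i + 1) * j) else 1
  set V' := ∏ i ∈ Finset.range (2 * s + 2 + n),
      if SmallEvenOrLargeOdd (s + 1) (i + 1) then ∑' j : ℕ, (X : ℤ⟦X⟧) ^ ((i + 1) * j) else 1
  linear_combination (-V * V') * h + (1 - X ^ (2 * s + 2)) * V' * h1 -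
    (1 - X ^ (2 * s + 1)) * V * h2

theorem smallEvenLargeOddSeries_zero :
    eulerSeries * smallEvenLargeOddSeries 0 = expand 2 two_ne_zero eulerSeries := by
  refine tendsto_nhds_unique
    ((tendsto_prod_one_sub_X_pow.mul (tendsto_smallEvenLargeOddSeries 0)).comp
      tendsto_two_mul_atTop) (tendsto_prod_one_sub_X_pow_even.congr fun n => ?_)
  have hZ : ∏ i ∈ Finset.range (2 * n),
      (if SmallEvenOrLargeOdd 0 (i + 1) then (1 - (X : ℤ⟦X⟧) ^ (i + 1)) else 1) =
      ∏ i ∈ Finset.range n, (1 - X ^ (2 * i + 1)) := by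
    induction n with
    | zero => simp
    | succ n ih =>
      have h1 : SmallEvenOrLargeOdd 0 (2 * n + 1) := by unfold SmallEvenOrLargeOdd; grind
      have h2 : ¬ SmallEvenOrLargeOdd 0 (2 * n + 1 + 1) := by unfold SmallEvenOrLargeOdd; grind
      rw [show 2 * (n + 1) = 2 * n + 1 + 1 by ring, Finset.prod_range_succ, Finset.prod_range_succ,
        Finset.prod_range_succ, if_pos h1, if_neg h2, ih, mul_one]
  have h := prod_smallEvenLargeOdd_mul_prod 0 (2 * n)
  rw [hZ] at h
  simp only [Function.comp_apply]
  rw [prod_one_sub_X_pow_two_mul]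
  linear_combination (- ∏ i ∈ Finset.range n, (1 - (X : ℤ⟦X⟧) ^ (2 * i + 2))) * h

/-! ### The generating function of Andrews' partitions -/

/-- The series `∑ₛ X^(s(2N+1)) Rₛ`, where `Rₛ` is the generating function of the partitions into
even parts up to `2 s` and odd parts above `2 s`. For `N = 0` the exponent of `X` in the `s`-th
term accounts for half of one copy of the largest even part `2 s`. -/
noncomputable def weightedSeries (N : ℕ) : ℤ⟦X⟧ :=
  .mk fun d => coeff d (∑ s ∈ Finset.range (d + 1), X ^ (s * (2 * N + 1)) *
    smallEvenLargeOddSeries s)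

theorem tendsto_weightedSeries (N : ℕ) :
    Tendsto (fun n => ∑ s ∈ Finset.range n, X ^ (s * (2 * N + 1)) * smallEvenLargeOddSeries s)
      atTop (𝓝 (weightedSeries N)) := by
  rw [tendsto_iff_coeff_tendsto]
  refine fun d => tendsto_atTop_of_eventually_const (i₀ := d + 1) fun n hn => ?_
  rw [weightedSeries, coeff_mk, map_sum, map_sum]
  symm
  refine Finset.sum_subset (Finset.range_mono hn) fun s _ hs => ?_
  rw [Finset.mem_range, not_lt] at hs
  exact X_pow_dvd_iff.1 (dvd_mul_right _ _) d (by nlinarith)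

theorem X_pow_dvd_weightedSeries_sub (N : ℕ) :
    (X : ℤ⟦X⟧) ^ N ∣ weightedSeries N - smallEvenLargeOddSeries 0 := by
  rw [X_pow_dvd_iff]
  intro d hd
  rw [weightedSeries, map_sub, coeff_mk, Finset.sum_range_succ', map_add, map_sum]
  simp only [zero_mul, pow_zero, one_mul, add_sub_cancel_right]
  exact Finset.sum_eq_zero fun s _ => X_pow_dvd_iff.1 (dvd_mul_right _ _) d (by nlinarith)

/-- The functional equation behind the `q`-binomial theorem. -/
theorem weightedSeries_succ (N : ℕ) :
    (1 - X ^ (2 * N + 1)) * weightedSeries N = (1 - X ^ (2 * N + 2)) * weightedSeries (N + 1) := by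
  have hfin : ∀ K, (1 - X ^ (2 * N + 1)) *
        ∑ s ∈ Finset.range K, X ^ (s * (2 * N + 1)) * smallEvenLargeOddSeries s =
      (1 - X ^ (2 * N + 2)) *
        ∑ s ∈ Finset.range K, X ^ (s * (2 * (N + 1) + 1)) * smallEvenLargeOddSeries s -
      X ^ (K * (2 * N + 1)) * ((1 - X ^ (2 * K)) * smallEvenLargeOddSeries K) := by
    intro K
    induction K with
    | zero => simp
    | succ K ih =>
      rw [Finset.sum_range_succ, Finset.sum_range_succ, mul_add, ih,
        show 2 * (K + 1) = 2 * K + 2 by ring, smallEvenLargeOddSeries_succ]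
      ring
  have herr : Tendsto (fun K => X ^ (K * (2 * N + 1)) *
      ((1 - X ^ (2 * K)) * smallEvenLargeOddSeries K)) atTop (𝓝 0) :=
    tendsto_zero_of_X_pow_dvd fun K => (pow_dvd_pow X (by nlinarith)).mul_right _
  refine tendsto_nhds_unique (((tendsto_weightedSeries N).const_mul _).congr hfin) ?_
  simpa using ((tendsto_weightedSeries (N + 1)).const_mul (1 - X ^ (2 * N + 2))).sub herr

theorem prod_mul_weightedSeries_zero (N : ℕ) :
    (∏ i ∈ Finset.range N, (1 - X ^ (2 * i + 1))) * weightedSeries 0 =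
      (∏ i ∈ Finset.range N, (1 - X ^ (2 * i + 2))) * weightedSeries N := by
  induction N with
  | zero => simp
  | succ N ih =>
    rw [Finset.prod_range_succ, Finset.prod_range_succ]
    linear_combination (1 - X ^ (2 * N + 1)) * ih +
      (∏ i ∈ Finset.range N, (1 - X ^ (2 * i + 2))) * weightedSeries_succ N

/-- Andrews: `∑ EObar(2n) qⁿ = f₂³ / f₁²`, with the denominator cleared. -/
theorem eulerSeries_sq_mul_weightedSeries :
    eulerSeries ^ 2 * weightedSeries 0 = expand 2 two_ne_zero eulerSeries ^ 3 := by
  have h : eulerSeries * weightedSeries 0 =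
      expand 2 two_ne_zero eulerSeries ^ 2 * smallEvenLargeOddSeries 0 := by
    refine tendsto_nhds_unique ((tendsto_prod_one_sub_X_pow.comp tendsto_two_mul_atTop).mul_const _)
      (((tendsto_prod_one_sub_X_pow_even.pow 2).mul
        (tendsto_of_X_pow_dvd_sub X_pow_dvd_weightedSeries_sub)).congr fun n => ?_)
    simp only [Function.comp_apply]
    rw [prod_one_sub_X_pow_two_mul]
    linear_combination
      (-∏ i ∈ Finset.range n, (1 - (X : ℤ⟦X⟧) ^ (2 * i + 2))) * prod_mul_weightedSeries_zero n
  linear_combination eulerSeries * h +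
    expand 2 two_ne_zero eulerSeries ^ 2 * smallEvenLargeOddSeries_zero

/-! ### Halving the partitions -/

section Halving

/-- Half of the largest even part, or `0` if there are no even parts. -/
def halfLargestEven {n : ℕ} (P : n.Partition) : ℕ :=
  (P.parts.toFinset.filter Even).sup id / 2

/-- One copy of the part `2 s`, or nothing if `s = 0`. -/
def singletonTwoMul (s : ℕ) : Multiset ℕ := if s = 0 then 0 else {2 * s}

theorem sum_singletonTwoMul (s : ℕ) : (singletonTwoMul s).sum = 2 * s := by
  unfold singletonTwoMul
  split_ifs with h <;> simp [h]

theorem mem_singletonTwoMul {s a : ℕ} : a ∈ singletonTwoMul s ↔ a = 2 * s ∧ s ≠ 0 := by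
  unfold singletonTwoMul
  split_ifs with h <;> simp [h]

theorem count_singletonTwoMul (s a : ℕ) :
    (singletonTwoMul s).count a = if a = 2 * s ∧ s ≠ 0 then 1 else 0 := by
  unfold singletonTwoMul
  split_ifs with h h' h' <;> simp_all

variable {n : ℕ} {P : n.Partition} {s : ℕ}

theorem le_two_mul_halfLargestEven {a : ℕ} (ha : a ∈ P.parts) (he : Even a) :
    a ≤ 2 * halfLargestEven P := by
  have : a ≤ (P.parts.toFinset.filter Even).sup id :=
    Finset.le_sup (f := id) (Finset.mem_filter.2 ⟨Multiset.mem_toFinset.2 ha, he⟩)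
  unfold halfLargestEven
  grind

theorem two_mul_halfLargestEven_mem (h : halfLargestEven P ≠ 0) :
    2 * halfLargestEven P ∈ P.parts := by
  have hne : (P.parts.toFinset.filter Even).Nonempty := by
    by_contra hcon
    rw [Finset.not_nonempty_iff_eq_empty] at hcon
    simp [halfLargestEven, hcon] at h
  obtain ⟨a, ha, hsup⟩ := Finset.exists_mem_eq_sup _ hne id
  rw [Finset.mem_filter, Multiset.mem_toFinset] at ha
  have : 2 * halfLargestEven P = a := by
    rw [halfLargestEven, hsup]
    exact Nat.mul_div_cancel' ha.2.two_dvd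
  rw [this]
  exact ha.1

theorem isLargestEvenPart_iff {a : ℕ} :
    IsLargestEvenPart P a ↔ a = 2 * halfLargestEven P ∧ halfLargestEven P ≠ 0 := by
  constructor
  · rintro ⟨h1, h2, h3⟩
    have hle := le_two_mul_halfLargestEven h1 h2
    have hpos := P.parts_pos h1
    have hne : halfLargestEven P ≠ 0 := by lia
    exact ⟨le_antisymm hle (h3 _ (two_mul_halfLargestEven_mem hne) (even_two_mul _)), hne⟩
  · rintro ⟨rfl, h⟩
    exact ⟨two_mul_halfLargestEven_mem h, even_two_mul _,
      fun b hb he => le_two_mul_halfLargestEven hb he⟩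

theorem exists_half_of_onlyLargestEvenOdd (hP : OnlyLargestEvenOdd P) :
    ∃ Q : Multiset ℕ, P.parts = 2 • Q + singletonTwoMul (halfLargestEven P) ∧
      ∀ a ∈ Q, SmallEvenOrLargeOdd (halfLargestEven P) a := by
  set s := halfLargestEven P with hs
  have hle : singletonTwoMul s ≤ P.parts := by
    unfold singletonTwoMul
    split_ifs with h
    · exact Multiset.zero_le _
    · exact Multiset.singleton_le.2 (two_mul_halfLargestEven_mem h)
  obtain ⟨Q, hQ⟩ : ∃ Q, P.parts - singletonTwoMul s = 2 • Q := by
    apply Multiset.exists_smul_of_dvd_count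
    intro a ha
    have ha' : a ∈ P.parts := Multiset.mem_of_le (Multiset.sub_le_self _ _) ha
    have hodd := hP.2 a ha'
    rw [isLargestEvenPart_iff, ← hs] at hodd
    rw [Multiset.count_sub, count_singletonTwoMul]
    split_ifs with h
    · obtain ⟨c, hc⟩ := hodd.2 h
      exact ⟨c, by lia⟩
    · rw [tsub_zero]
      exact (Nat.not_odd_iff_even.1 fun h' => h (hodd.1 h')).two_dvd
  have hparts : P.parts = 2 • Q + singletonTwoMul s := by
    rw [← hQ, Multiset.sub_add_cancel hle]
  refine ⟨Q, hparts, fun a ha => ?_⟩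
  have ha' : a ∈ P.parts := by
    rw [hparts, two_nsmul, Multiset.mem_add, Multiset.mem_add]
    exact Or.inl (Or.inl ha)
  rcases Nat.even_or_odd a with he | ho
  · exact Or.inl ⟨he, le_two_mul_halfLargestEven ha' he⟩
  · refine Or.inr ⟨ho, ?_⟩
    rcases eq_or_ne s 0 with h0 | h0
    · have := P.parts_pos ha'
      lia
    · exact hP.1 _ (two_mul_halfLargestEven_mem h0) a ha' (even_two_mul _) ho

theorem onlyLargestEvenOdd_of_half {Q : Multiset ℕ} (hPQ : P.parts = 2 • Q + singletonTwoMul s)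
    (hQ : ∀ a ∈ Q, SmallEvenOrLargeOdd s a) :
    OnlyLargestEvenOdd P ∧ halfLargestEven P = s := by
  have hmem : ∀ a ∈ P.parts, (Even a ∧ a ≤ 2 * s) ∨ (Odd a ∧ 2 * s < a) := by
    intro a ha
    rw [hPQ, two_nsmul, Multiset.mem_add, Multiset.mem_add, or_self, mem_singletonTwoMul] at ha
    rcases ha with ha | ⟨rfl, -⟩
    · exact hQ a ha
    · exact Or.inl ⟨even_two_mul _, le_rfl⟩
  have hhalf : halfLargestEven P = s := by
    apply le_antisymm
    · by_contra hcon
      have := hmem _ (two_mul_halfLargestEven_mem (P := P) (by lia))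
      grind
    · rcases eq_or_ne s 0 with h0 | h0
      · lia
      · have h2s : 2 * s ∈ P.parts := by
          rw [hPQ, Multiset.mem_add, mem_singletonTwoMul]
          exact Or.inr ⟨rfl, h0⟩
        have := le_two_mul_halfLargestEven h2s (even_two_mul s)
        lia
  refine ⟨⟨?_, ?_⟩, hhalf⟩
  · intro a ha b hb hae hbo
    have := hmem a ha
    have := hmem b hb
    grind
  · intro a ha
    rw [isLargestEvenPart_iff, hhalf, hPQ, Multiset.count_add, Multiset.count_nsmul,
      count_singletonTwoMul]
    split_ifs with h <;> grind

end Halving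

open Classical in
/-- Removing one copy of the largest even part leaves every multiplicity even; halving the
multiplicities leaves a partition into even parts up to `2 s` and odd parts above `2 s`. -/
theorem eoBarNat_two_mul (n : ℕ) :
    eoBarNat (2 * n) = ∑ s ∈ Finset.range (n + 1),
      (Nat.Partition.restricted (n - s) (SmallEvenOrLargeOdd s)).card := by
  rw [eoBarNat, Nat.card_eq_fintype_card, Fintype.card_subtype,
    Finset.card_eq_sum_card_fiberwise (f := halfLargestEven) (t := Finset.range (n + 1))]
  · refine Finset.sum_congr rfl fun s hs => ?_
    rw [Finset.mem_range] at hs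
    symm
    refine Finset.card_bij (fun Q _ => (⟨2 • Q.parts + singletonTwoMul s, ?_, ?_⟩ :
      (2 * n).Partition)) ?_ ?_ ?_
    · intro a ha
      rw [two_nsmul, Multiset.mem_add, Multiset.mem_add, or_self, mem_singletonTwoMul] at ha
      rcases ha with ha | ⟨rfl, h0⟩
      · exact Q.parts_pos ha
      · lia
    · rw [Multiset.sum_add, Multiset.sum_nsmul, Q.parts_sum, sum_singletonTwoMul, smul_eq_mul]
      lia
    · intro Q hQ
      rw [Nat.Partition.restricted, Finset.mem_filter] at hQ
      rw [Finset.mem_filter, Finset.mem_filter]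
      refine (fun h => ⟨⟨Finset.mem_univ _, h.1⟩, h.2⟩) (onlyLargestEvenOdd_of_half ?_ hQ.2)
      rfl
    · intro Q _ Q' _ h
      rw [Nat.Partition.ext_iff] at h
      simp only [add_left_inj] at h
      refine Nat.Partition.ext (Multiset.ext.2 fun a => ?_)
      have := congrArg (Multiset.count a) h
      rw [Multiset.count_nsmul, Multiset.count_nsmul] at this
      lia
    · intro P hP
      rw [Finset.mem_filter, Finset.mem_filter] at hP
      obtain ⟨⟨-, hP⟩, rfl⟩ := hP
      obtain ⟨Q, hPQ, hQ⟩ := exists_half_of_onlyLargestEvenOdd hP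
      have hsum := P.parts_sum
      rw [hPQ, Multiset.sum_add, Multiset.sum_nsmul, sum_singletonTwoMul, smul_eq_mul] at hsum
      refine ⟨⟨Q, fun {a} ha => P.parts_pos ?_, by lia⟩, ?_, ?_⟩
      · rw [hPQ, two_nsmul, Multiset.mem_add, Multiset.mem_add]
        exact Or.inl (Or.inl ha)
      · rw [Nat.Partition.restricted, Finset.mem_filter]
        exact ⟨Finset.mem_univ _, hQ⟩
      · exact Nat.Partition.ext hPQ.symm
  · intro P _
    rw [Finset.mem_coe, Finset.mem_range]
    by_cases h0 : halfLargestEven P = 0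
    · lia
    · have h := Multiset.le_sum_of_mem (two_mul_halfLargestEven_mem h0)
      rw [P.parts_sum] at h
      lia

theorem coeff_weightedSeries_zero (n : ℕ) : coeff n (weightedSeries 0) = eoBarNat (2 * n) := by
  rw [weightedSeries, coeff_mk, map_sum, eoBarNat_two_mul, Nat.cast_sum]
  refine Finset.sum_congr rfl fun s hs => ?_
  rw [Finset.mem_range] at hs
  rw [mul_zero, zero_add, mul_one, coeff_X_pow_mul', if_pos (by lia), smallEvenLargeOddSeries,
    coeff_mk]

end Series

section Reduction

open PowerSeries

/-! ### Reduction modulo eight -/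

/-- Frobenius on power series over the field with two elements. -/
theorem PowerSeries.expand_two_eq_sq (f : (ZMod 2)⟦X⟧) : expand 2 two_ne_zero f = f ^ 2 := by
  have h := MvPowerSeries.map_frobenius_expand (σ := Unit) (R := ZMod 2) 2 two_ne_zero (f := f)
  rw [ZMod.frobenius_zmod, MvPowerSeries.map_id] at h
  exact h

theorem PowerSeries.exists_eq_add_two_mul {f g : ℤ⟦X⟧}
    (h : map (Int.castRingHom (ZMod 2)) f = map (Int.castRingHom (ZMod 2)) g) :
    ∃ z, f = g + 2 * z := by
  refine ⟨.mk fun n => (coeff n f - coeff n g) / 2, ?_⟩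
  ext n
  have hn := congrArg (coeff n) h
  simp only [coeff_map, eq_intCast] at hn
  have hd : (2 : ℤ) ∣ coeff n f - coeff n g := by
    have := (ZMod.intCast_eq_intCast_iff_dvd_sub _ _ 2).1 hn
    lia
  rw [map_add, show (2 : ℤ⟦X⟧) = C 2 by simp, coeff_C_mul, coeff_mk, Int.mul_ediv_cancel' hd]
  ring

theorem exists_altSquareSeries_sq :
    ∃ z, altSquareSeries ^ 2 = expand 2 two_ne_zero altSquareSeries + 2 * z := by
  apply exists_eq_add_two_mul
  rw [map_pow, map_expand, expand_two_eq_sq]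

/-- The odd squares contribute `-X ψ(X⁸)` to `T`. -/
theorem exists_altSquareSeries_eq :
    ∃ b, altSquareSeries =
      expand 2 two_ne_zero b - X * expand 8 (by norm_num) triangularSeries := by
  refine ⟨.mk fun n => coeff (2 * n) (altSquareSeries +
    X * expand 8 (by norm_num) triangularSeries), ?_⟩
  rw [eq_sub_iff_add_eq]
  ext n
  rw [coeff_expand]
  split_ifs with hn
  · rw [coeff_mk, Nat.mul_div_cancel' hn]
  · cases n with
    | zero => simp at hn
    | succ n =>
      rw [map_add, coeff_succ_X_mul, coeff_expand, altSquareSeries, coeff_mk]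
      have hodd : Odd (n + 1) := by grind
      rw [hodd.neg_one_pow]
      by_cases hsq : IsSquare (n + 1)
      · have h8 : 8 ∣ n := by
          obtain ⟨r, hr⟩ := hsq
          have hro : Odd r := by
            by_contra h
            rw [hr] at hodd
            exact h (Nat.odd_mul.1 hodd).1
          have := Nat.eight_dvd_sq_sub_one_of_odd hro
          rwa [sq, ← hr, Nat.add_sub_cancel] at this
        rw [if_pos ⟨hsq, by simp⟩, if_pos h8, triangularSeries, coeff_mk, Nat.mul_div_cancel' h8,
          if_pos hsq]
        simp
      · rw [if_neg fun h => hsq h.1]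
        split_ifs with h8
        · rw [triangularSeries, coeff_mk, Nat.mul_div_cancel' h8, if_neg hsq]
          simp
        · simp

/-- `φ(-q) ∑ EObar(2n) qⁿ = f₂²`. -/
theorem weightedSeries_zero_mul :
    weightedSeries 0 * (1 + 2 * altSquareSeries) = expand 2 two_ne_zero eulerSeries ^ 2 := by
  apply mul_left_cancel₀ (expand_eulerSeries_ne_zero two_ne_zero)
  linear_combination weightedSeries 0 * expand_two_eulerSeries_mul_one_add +
    eulerSeries_sq_mul_weightedSeries

/-- The series `f₁ ψ(q²) ψ(q⁴)`, whose coefficients govern `EObar(8n+6)` modulo `8`. -/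
noncomputable def thetaProductSeries : ℤ⟦X⟧ :=
  expand 2 two_ne_zero triangularSeries * expand 4 four_ne_zero triangularSeries * eulerSeries

/-- Multiplying `weightedSeries_zero_mul` by `(1 - 2 T) (1 + 4 T²)`, with `T² ≡ T(q²)` modulo `2`,
inverts `1 + 2 T` modulo `8`. Of the terms below, only the last two contribute to the exponents
`4 n + 3`. -/
theorem exists_weightedSeries_zero_eq :
    ∃ v v' z, weightedSeries 0 = expand 2 two_ne_zero v +
      X * expand 4 four_ne_zero v' - 4 * (X ^ 3 * expand 4 four_ne_zero thetaProductSeries) +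
      8 * z := by
  obtain ⟨z, hz⟩ := exists_altSquareSeries_sq
  obtain ⟨b, hb⟩ := exists_altSquareSeries_eq
  have h1 := weightedSeries_zero_mul
  have hT := congrArg (expand 2 two_ne_zero) expand_two_eulerSeries_mul_one_add
  have hcomp4 : ∀ f : ℤ⟦X⟧, expand 4 four_ne_zero f =
      expand 2 two_ne_zero (expand 2 two_ne_zero f) :=
    fun f => expand_mul 2 two_ne_zero 2 two_ne_zero f
  have hcomp8 : ∀ f : ℤ⟦X⟧, expand 8 (by norm_num) f =
      expand 2 two_ne_zero (expand 2 two_ne_zero (expand 2 two_ne_zero f)) := fun f => by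
    rw [← hcomp4]
    exact expand_mul 4 four_ne_zero 2 two_ne_zero f
  have hb2 := congrArg (expand 2 two_ne_zero) hb
  rw [hcomp8] at hb hb2
  simp only [map_mul, map_add, map_sub, map_one, map_pow, map_ofNat, expand_X] at hT hb2
  set E : ℤ⟦X⟧ →ₐ[ℤ] ℤ⟦X⟧ := expand 2 two_ne_zero
  set F := weightedSeries 0
  set T := altSquareSeries
  set A : ℤ⟦X⟧ := X * E (E (E triangularSeries)) with hA
  refine ⟨eulerSeries ^ 2 * (1 - 2 * b) * (1 + 4 * T),
    2 * (E triangularSeries * (eulerSeries * (1 + 2 * b))),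
    E eulerSeries ^ 2 * (1 - 2 * T) * z + A * E T * E eulerSeries ^ 2 + 2 * F * T ^ 4, ?_⟩
  simp only [thetaProductSeries, hcomp4, map_mul, map_add, map_sub, map_one, map_pow, map_ofNat]
  linear_combination (1 - 2 * T) * (1 + 4 * T ^ 2) * h1 +
    4 * E eulerSeries ^ 2 * (1 - 2 * T) * hz - 2 * E eulerSeries ^ 2 * (1 + 4 * E T) * hb -
    2 * A * hT + 4 * A * E (E eulerSeries) * hb2

theorem eoBarNat_eight_mul_add_six_emod (n : ℕ) :
    (eoBarNat (8 * n + 6) : ℤ) ≡ 4 * coeff n thetaProductSeries [ZMOD 8] := by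
  obtain ⟨v, v', z, h⟩ := exists_weightedSeries_zero_eq
  have hc := congrArg (coeff (4 * n + 3)) h
  have h4 : (4 : ℤ⟦X⟧) = C 4 := by simp
  have h8 : (8 : ℤ⟦X⟧) = C 8 := by simp
  rw [coeff_weightedSeries_zero, map_add, map_sub, map_add, h4, h8, coeff_C_mul, coeff_C_mul,
    show 4 * n + 3 = 4 * n + 2 + 1 by ring, coeff_succ_X_mul,
    coeff_expand_of_not_dvd 2 _ _ (by lia), coeff_expand_of_not_dvd 4 _ _ (by lia),
    show 4 * n + 2 + 1 = 4 * n + 3 by ring, coeff_X_pow_mul, coeff_expand_mul,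
    show 2 * (4 * n + 3) = 8 * n + 6 by ring] at hc
  rw [hc]
  exact Int.modEq_iff_dvd.2 ⟨coeff n thetaProductSeries - coeff (4 * n + 3) z, by ring⟩

/-- Over the field with two elements `ψ = f₁³`, so that `f₁ ψ(q²) ψ(q⁴) = f₁¹⁹ = ψ f₁₆`. -/
theorem map_thetaProductSeries :
    map (Int.castRingHom (ZMod 2)) thetaProductSeries =
      map (Int.castRingHom (ZMod 2))
        (triangularSeries * expand 16 (by norm_num) eulerSeries) := by
  have hE : map (Int.castRingHom (ZMod 2)) eulerSeries ≠ 0 := by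
    intro h
    have h0 := congrArg (coeff (pentagonal 0)) h
    rw [coeff_map, eulerSeries, coeff_pentagonalSeries_pentagonal] at h0
    simp at h0
  have hcomp4 : ∀ f : (ZMod 2)⟦X⟧, expand 4 four_ne_zero f = f ^ 4 := fun f => by
    rw [show expand 4 four_ne_zero f = expand 2 two_ne_zero (expand 2 two_ne_zero f) from
      expand_mul 2 two_ne_zero 2 two_ne_zero f, expand_two_eq_sq, expand_two_eq_sq]
    ring
  have hcomp16 : ∀ f : (ZMod 2)⟦X⟧, expand 16 (by norm_num) f = f ^ 16 := fun f => by
    rw [show expand 16 (by norm_num) f = expand 4 four_ne_zero (expand 4 four_ne_zero f) from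
      expand_mul 4 four_ne_zero 4 four_ne_zero f, hcomp4, hcomp4]
    ring
  have hpsi : map (Int.castRingHom (ZMod 2)) triangularSeries =
      map (Int.castRingHom (ZMod 2)) eulerSeries ^ 3 := by
    apply mul_left_cancel₀ hE
    have h := congrArg (map (Int.castRingHom (ZMod 2))) eulerSeries_mul_triangularSeries
    rw [map_mul, map_pow, map_expand, expand_two_eq_sq] at h
    rw [h]
    ring
  rw [thetaProductSeries, map_mul, map_mul, map_mul, map_expand, map_expand, map_expand, hpsi,
    expand_two_eq_sq, hcomp4, hcomp16]
  ring

/-! ### Coefficients as numbers of representations -/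

theorem isSquare_twentyFour_mul_add_one_iff {c : ℕ} :
    IsSquare (24 * c + 1) ↔ c ∈ Set.range pentagonal := by
  constructor
  · rintro ⟨r, hr⟩
    have hr6 : r % 6 = 1 ∨ r % 6 = 5 := by
      have h := congrArg (· % 6) hr
      simp only [Nat.mul_mod r r] at h
      have : r % 6 < 6 := Nat.mod_lt _ (by norm_num)
      interval_cases r % 6 <;> lia
    have hr' : (r : ℤ) * r = 24 * c + 1 := by exact_mod_cast hr.symm
    rcases hr6 with h | h
    · obtain ⟨k, hk⟩ : ∃ k : ℤ, (r : ℤ) = 6 * k + 1 := ⟨r / 6, by lia⟩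
      refine ⟨-k, ?_⟩
      zify
      have := two_mul_natCast_pentagonal_neg k
      rw [hk] at hr'
      nlinarith
    · obtain ⟨k, hk⟩ : ∃ k : ℤ, (r : ℤ) = 6 * k - 1 := ⟨r / 6 + 1, by lia⟩
      refine ⟨k, ?_⟩
      zify
      have := two_mul_natCast_pentagonal k
      rw [hk] at hr'
      nlinarith
  · rintro ⟨k, rfl⟩
    refine ⟨(6 * k - 1).natAbs, ?_⟩
    zify
    rw [abs_mul_abs_self]
    have := two_mul_natCast_pentagonal k
    nlinarith

theorem intCast_coeff_eulerSeries (c : ℕ) :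
    ((coeff c eulerSeries : ℤ) : ZMod 2) = if IsSquare (24 * c + 1) then 1 else 0 := by
  rw [eulerSeries]
  split_ifs with h
  · obtain ⟨k, rfl⟩ := isSquare_twentyFour_mul_add_one_iff.1 h
    rw [coeff_pentagonalSeries_pentagonal]
    rcases Int.even_or_odd k with hk | hk
    · simp [Int.negOnePow_even k hk]
    · simp [Int.negOnePow_odd k hk]
  · rw [coeff_pentagonalSeries_eq_zero ℤ fun h' => h (isSquare_twentyFour_mul_add_one_iff.2 h')]
    simp

/-- The integers with square `m`. -/
noncomputable def intSqrts (m : ℕ) : Finset ℤ :=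
  (Finset.Icc (-(m : ℤ)) m).filter fun x => x ^ 2 = m

theorem mem_intSqrts {m : ℕ} {x : ℤ} : x ∈ intSqrts m ↔ x ^ 2 = m := by
  simp only [intSqrts, Finset.mem_filter, Finset.mem_Icc, and_iff_right_iff_imp]
  intro h
  have h1 := Int.le_self_sq x
  have h2 := Int.le_self_sq (-x)
  rw [neg_sq] at h2
  lia

theorem card_intSqrts {m : ℕ} (hm : m ≠ 0) :
    (intSqrts m).card = 2 * if IsSquare m then 1 else 0 := by
  split_ifs with h
  · obtain ⟨r, rfl⟩ := h
    have hr : (r : ℤ) ≠ 0 := by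
      intro h0
      simp_all
    have : intSqrts (r * r) = {(r : ℤ), -(r : ℤ)} := by
      ext x
      rw [mem_intSqrts, Nat.cast_mul, ← sq, sq_eq_sq_iff_eq_or_eq_neg]
      simp
    rw [this, Finset.card_pair (by lia)]
  · rw [mul_zero, Finset.card_eq_zero, Finset.eq_empty_iff_forall_notMem]
    intro x hx
    rw [mem_intSqrts] at hx
    apply h
    refine ⟨x.natAbs, ?_⟩
    zify
    rw [← hx, abs_mul_abs_self, sq]

/-- With `x² = 8 a + 1` and `y² = 24 c + 1`, the equation `3x² + 16y² = 24 n + 19` becomes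
`a + 16 c = n`. -/
theorem card_repsOfParity_one (n : ℕ) :
    (repsOfParity 1 (24 * n + 19)).card =
      4 * ∑ ab ∈ Finset.HasAntidiagonal.antidiagonal n, (if IsSquare (8 * ab.1 + 1) then 1 else 0) *
        (if 16 ∣ ab.2 then if IsSquare (24 * (ab.2 / 16) + 1) then 1 else 0 else 0) := by
  have hx8 : ∀ z ∈ repsOfParity 1 (24 * n + 19), z.1 ^ 2 % 8 = 1 ∧ z.2 ^ 2 % 24 = 1 ∧
      3 * z.1 ^ 2 + 16 * z.2 ^ 2 = 24 * n + 19 := by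
    intro z hz
    rw [mem_repsOfParity] at hz
    obtain ⟨hz, hz2⟩ := hz
    have hx := sq_emod_eight z.1
    have hy := sq_emod_eight z.2
    have hyo : z.2 ^ 2 % 8 = 1 := by
      obtain ⟨c, hc⟩ := hz2
      have : z.2 ^ 2 = 2 * (2 * c ^ 2 + 2 * c) + 1 := by
        rw [show z.2 = 2 * c + 1 by lia]; ring
      lia
    lia
  rw [Finset.card_eq_sum_card_fiberwise (t := Finset.HasAntidiagonal.antidiagonal n)
    (f := fun z : ℤ × ℤ => (((z.1 ^ 2 - 1) / 8).toNat, (16 * ((z.2 ^ 2 - 1) / 24)).toNat)),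
    Finset.mul_sum]
  · refine Finset.sum_congr rfl ?_
    rintro ⟨a, b⟩ hab
    rw [Finset.HasAntidiagonal.mem_antidiagonal] at hab
    simp only at hab ⊢
    by_cases hb : 16 ∣ b
    · have hfib : (repsOfParity 1 (24 * n + 19)).filter (fun z =>
          (((z.1 ^ 2 - 1) / 8).toNat, (16 * ((z.2 ^ 2 - 1) / 24)).toNat) = (a, b)) =
          intSqrts (8 * a + 1) ×ˢ intSqrts (24 * (b / 16) + 1) := by
        ext z
        rw [Finset.mem_filter, Finset.mem_product, mem_intSqrts, mem_intSqrts, Prod.mk.injEq]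
        push_cast
        have := sq_nonneg z.1
        have := sq_nonneg z.2
        constructor
        · rintro ⟨hz, h1, h2⟩
          have := hx8 z hz
          lia
        · rintro ⟨h1, h2⟩
          rw [mem_repsOfParity]
          refine ⟨⟨by lia, ?_⟩, by lia, by lia⟩
          by_contra hodd
          obtain ⟨c, hc⟩ : (2 : ℤ) ∣ z.2 := by lia
          have : z.2 ^ 2 = 2 * (2 * c ^ 2) := by rw [hc]; ring
          lia
      rw [hfib, Finset.card_product, card_intSqrts (by lia), card_intSqrts (by lia), if_pos hb]
      ring
    · rw [if_neg hb, mul_zero, mul_zero, Finset.card_eq_zero, Finset.filter_eq_empty_iff]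
      intro z hz h
      have := hx8 z hz
      have := sq_nonneg z.2
      rw [Prod.mk.injEq] at h
      lia
  · intro z hz
    have hz' := hx8 z hz
    have := sq_nonneg z.1
    have := sq_nonneg z.2
    rw [Finset.mem_coe, Finset.HasAntidiagonal.mem_antidiagonal]
    simp only
    lia

/-- Modulo `8`, the number `EObar(8n+6)` counts the representations of `24 n + 19` by
`3x² + 16y²` with `y` odd. -/
theorem eoBarNat_eight_mul_add_six (n : ℕ) :
    eoBarNat (8 * n + 6) ≡ (repsOfParity 1 (24 * n + 19)).card [MOD 8] := by
  set k := ∑ ab ∈ Finset.HasAntidiagonal.antidiagonal n,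
    (if IsSquare (8 * ab.1 + 1) then 1 else 0) *
      (if 16 ∣ ab.2 then if IsSquare (24 * (ab.2 / 16) + 1) then 1 else 0 else 0) with hk
  have hcoeff : ((coeff n thetaProductSeries : ℤ) : ZMod 2) = ((k : ℤ) : ZMod 2) := by
    have h := congrArg (coeff n) map_thetaProductSeries
    simp only [coeff_map, eq_intCast] at h
    rw [h, coeff_mul, hk]
    push_cast
    refine Finset.sum_congr rfl fun ab _ => ?_
    rw [coeff_expand, triangularSeries, coeff_mk]
    congr 1
    · split_ifs <;> simp
    · by_cases h : 16 ∣ ab.2 <;> simp [h, intCast_coeff_eulerSeries]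
  have hdvd : (2 : ℤ) ∣ k - coeff n thetaProductSeries :=
    (ZMod.intCast_eq_intCast_iff_dvd_sub _ _ 2).1 hcoeff
  rw [card_repsOfParity_one, ← Int.natCast_modEq_iff]
  refine (eoBarNat_eight_mul_add_six_emod n).trans (Int.modEq_iff_dvd.2 ?_)
  obtain ⟨c, hc⟩ := hdvd
  refine ⟨c, ?_⟩
  rw [← hk]
  push_cast
  linear_combination 4 * hc

end Reduction

/-! ### The congruence at primes of odd exponent -/

/-- `EObar(v)` is divisible by `8` as soon as some prime `p ≡ 1 (mod 24)` divides `3 v + 1`, which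
is to be `≡ 19 (mod 24)`, to an odd power. -/
theorem EOBar_modEq_zero {p : ℕ} (hp : p.Prime) (hp24 : p % 24 = 1) {v m : ℤ}
    (hm : m % 24 = 19) (hpm : ¬ (p : ℤ) ∣ m) (a : ℕ) (hv : 3 * v + 1 = p ^ (2 * a + 1) * m) :
    EOBar v ≡ 0 [MOD 8] := by
  by_cases h0 : 0 ≤ v
  · have hpow : ((p : ℤ) ^ (2 * a + 1)) % 24 = 1 := by
      have h1 : (p : ℤ) ≡ 1 [ZMOD 24] := by simp only [Int.ModEq]; lia
      simpa [Int.ModEq] using h1.pow (2 * a + 1)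
    have hv24 : (3 * v + 1) % 24 = 19 := by rw [hv, Int.mul_emod, hpow, hm]; norm_num
    obtain ⟨n, rfl⟩ : ∃ n : ℕ, v = ((8 * n + 6 : ℕ) : ℤ) := ⟨(v / 8).toNat, by lia⟩
    rw [EOBar, if_pos h0, Int.toNat_natCast]
    refine (eoBarNat_eight_mul_add_six n).trans ?_
    have h := eight_dvd_card_repsOfParity hp hp24 hpm hm 1 a
    rw [← hv, show 3 * ((8 * n + 6 : ℕ) : ℤ) + 1 = 24 * n + 19 by push_cast; ring] at h
    exact (Nat.modEq_zero_iff_dvd).2 h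
  · rw [EOBar, if_neg h0]

/-- The case `3 v + 1 = P² p m` with `p ∤ m`, where `p` may divide `P`. -/
theorem EOBar_modEq_zero_of_sq_mul {p P : ℕ} (hp : p.Prime) (hp24 : p % 24 = 1)
    (hP : P % 24 = 1) {v m : ℤ} (hm : m % 24 = 19) (hpm : ¬ (p : ℤ) ∣ m)
    (hv : 3 * v + 1 = P ^ 2 * p * m) : EOBar v ≡ 0 [MOD 8] := by
  obtain ⟨a, Q, hQ, rfl⟩ :=
    Nat.exists_eq_pow_mul_and_not_dvd (n := P) (by rintro rfl; simp at hP) p hp.ne_one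
  have hpow : (p ^ a) % 24 = 1 := by simp [Nat.pow_mod, hp24]
  have hQ24 : (Q : ℤ) ≡ 1 [ZMOD 24] := by
    rw [Nat.mul_mod, hpow, one_mul, Nat.mod_mod] at hP
    simp only [Int.ModEq]; lia
  have hpZ : Prime (p : ℤ) := Nat.prime_iff_prime_int.1 hp
  refine EOBar_modEq_zero hp hp24 (m := Q ^ 2 * m) ?_ ?_ a ?_
  · simpa [Int.ModEq, hm] using (hQ24.pow 2).mul_right m
  · intro h
    rcases hpZ.dvd_or_dvd h with h | h
    · exact hQ (by exact_mod_cast hpZ.dvd_of_dvd_pow h)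
    · exact hpm h
  · rw [hv]; push_cast; ring

theorem theorem1p2 :
    (∀ (k : ℕ) (p : Fin (k + 1) → ℕ),
      (∀ i, (p i).Prime ∧ p i ≡ 1 [MOD 24] ∧ EOBar ((19 * (p i : ℤ) - 1) / 3) ≡ 0 [MOD 8]) →
      ∀ j : ℤ, ¬ (j ≡ 0 [ZMOD (p (Fin.last k) : ℤ)]) →
      (3 : ℤ) ∣ (∏ i : Fin k, (p i.castSucc : ℤ) ^ 2) * (p (Fin.last k) : ℤ)
          * (24 * j + 19 * (p (Fin.last k) : ℤ)) - 1 ∧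
      ∀ n : ℕ,
        EOBar (8 * (∏ i : Fin (k + 1), (p i : ℤ) ^ 2) * (n : ℤ)
          + ((∏ i : Fin k, (p i.castSucc : ℤ) ^ 2) * (p (Fin.last k) : ℤ)
              * (24 * j + 19 * (p (Fin.last k) : ℤ)) - 1) / 3) ≡ 0 [MOD 8]) ∧
    (∀ (n : ℕ) (j : ℤ), ¬ ((1009 : ℤ) ∣ j) →
      EOBar (8144648 * (n : ℤ) + 8072 * j + 6447846) ≡ 0 [MOD 8]) := by
  have hndvd : ∀ (q : ℕ) (j : ℤ) (n : ℕ), q.Prime → q % 24 = 1 → ¬ (q : ℤ) ∣ j →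
      ¬ (q : ℤ) ∣ 24 * (q * n + j) + 19 * q := by
    intro q j n hq hq24 hj h
    have h24 : (q : ℤ) ∣ 24 * j := by
      have := dvd_sub h (dvd_mul_right (q : ℤ) (24 * n + 19))
      ring_nf at this ⊢
      exact this
    have hcop : IsCoprime (q : ℤ) 24 := ⟨1, -(q / 24 : ℕ), by lia⟩
    exact hj (hcop.dvd_of_dvd_mul_left h24)
  refine ⟨fun k p hp j hj => ?_, fun n j hj => ?_⟩
  · set q := p (Fin.last k) with hq
    have hqp : q.Prime := (hp _).1
    have hq24 : q % 24 = 1 := (hp (Fin.last k)).2.1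
    set P := ∏ i : Fin k, p i.castSucc with hP
    have hP24 : P % 24 = 1 := by
      have h : P ≡ ∏ _i : Fin k, 1 [MOD 24] := by
        rw [hP]
        exact Nat.ModEq.prod fun i _ => (hp i.castSucc).2.1
      rw [Finset.prod_const_one] at h
      exact h
    have hPZ : ∏ i : Fin k, (p i.castSucc : ℤ) ^ 2 = (P : ℤ) ^ 2 := by
      rw [Finset.prod_pow, hP, Nat.cast_prod]
    rw [Fin.prod_univ_castSucc, hPZ, ← hq]
    have hmod : ((P : ℤ) ^ 2 * q * (24 * j + 19 * q)) % 24 = 19 := by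
      have hP1 : (P : ℤ) ≡ 1 [ZMOD 24] := by simp only [Int.ModEq]; lia
      have hq1 : (q : ℤ) ≡ 1 [ZMOD 24] := by simp only [Int.ModEq]; lia
      have hm : 24 * j + 19 * (q : ℤ) ≡ 19 [ZMOD 24] := by simp only [Int.ModEq]; lia
      simpa [Int.ModEq] using ((hP1.pow 2).mul hq1).mul hm
    refine ⟨by lia, fun n => ?_⟩
    refine EOBar_modEq_zero_of_sq_mul hqp hq24 hP24 (m := 24 * (q * n + j) + 19 * q)
      (by lia) (hndvd q j n hqp hq24 fun h => hj (Int.modEq_zero_iff_dvd.2 h)) ?_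
    have h3 : 3 * (((P : ℤ) ^ 2 * q * (24 * j + 19 * q) - 1) / 3) =
        (P : ℤ) ^ 2 * q * (24 * j + 19 * q) - 1 := Int.mul_ediv_cancel' (by lia)
    linear_combination h3
  · refine EOBar_modEq_zero_of_sq_mul (p := 1009) (P := 1) (by norm_num) (by norm_num)
      (by norm_num) (m := 24 * ((1009 : ℕ) * n + j) + 19 * (1009 : ℕ)) (by push_cast; lia)
      (hndvd 1009 j n (by norm_num) (by norm_num) (by exact_mod_cast hj)) ?_
    push_cast
    ring
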